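/- Let $n\ge 1$, $0<p<1$, $0<q\le\infty$, $s\in\mathbb{R}$, and let $\Phi:\mathbb{R}^n\to\mathbb{C}$ belong to $L^1_{\mathrm{loc}}(\mathbb{R}^n\setminus\{0\})$. The Hausdorff operator is $$H_\Phi f(x)=\int_{\mathbb{R}^n}\Phi(y)\,f\!\left(\frac{x}{|y|}\right)dy ,$$ and its natural domain $\mathrm{Dom}(H_\Phi)$ is the set of all measurable $f:\mathbb{R}^n\to\mathbb{C}$ for which this integral converges absolutely for almost every $x$. Function spaces. Let $\varphi\in C^\infty(\mathbb{R}^n;\mathbb{R})$ be supported in $\{|\xi|<3/2\}$ with $\varphi=1$ on $\{|\xi|\le 4/3\}$, put $\phi_0=\varphi$, $\phi_j(\xi)=\varphi(2^{-j}\xi)-\varphi(2\cdot 2^{-j}\xi)$ for $j\ge1$, and $\Delta_j=\mathscr{F}^{-1}\phi_j\mathscr{F}$. Let $\eta\in C^\infty(\mathbb{R}^n;[0,1])$ with $\eta(\xi)=1$ for $|\xi|_\infty\le 1/2$ and $\eta(\xi)=0$ for $|\xi|_\infty\ge 3/4$, put $\sigma_k(\xi)=\eta(\xi-k)\big/\sum_{l\in\mathbb{Z}^n}\eta(\xi-l)$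 and $\Box_k=\mathscr{F}^{-1}\sigma_k\mathscr{F}$ for $k\in\mathbb{Z}^n$. With $\langle k\rangle=(1+|k|^2)^{1/2}$, the spaces $F_s^{p,q}$, $B_s^{p,q}$, $M_s^{p,q}$ consist of all tempered distributions $f$ on $\mathbb{R}^n$ for which, respectively, $$\|f\|_{F_s^{p,q}}=\Big\|\Big(\sum_{j\ge0}2^{jsq}|\Delta_jf|^q\Big)^{1/q}\Big\|_{L^p},\quad \|f\|_{B_s^{p,q}}=\Big(\sum_{j\ge0}2^{jsq}\|\Delta_jf\|_{L^p}^q\Big)^{1/q},\quad \|f\|_{M_s^{p,q}}=\Big(\sum_{k\in\mathbb{Z}^n}\langle k\rangle^{sq}\|\Box_kf\|_{L^p}^q\Big)^{1/q}$$ is finite (with a supremum in place of the sum if $q=\infty$). A locally integrable function is regarded as an element of such a space if it coincides, as a distribution, with a tempered distribution in the space. Let $X$ be any of $F_s^{p,q}$, $B_s^{p,q}$, $M_s^{p,q}$, and let $\mathcal{D}$ be any set of functions with $C_c^\infty(\mathbb{R}^n\setminus\{0\})\subset\mathcal{D}\subset\mathrm{Dom}(H_\Phi)$ (for instance $\mathcal{D}=\mathrm{Dom}(H_\Phi)$).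 Say that $H_\Phi$, with domain $\mathcal{D}$, is bounded on $X$ if there is a constant $C<\infty$ such that, for every $f\in\mathcal{D}\cap X$, one has $H_\Phi f\in X$ and $\|H_\Phi f\|_X\le C\|f\|_X$. Then $$H_\Phi\ \text{is bounded on}\ X\iff H_\Phi=0,$$ where $H_\Phi=0$ means that $H_\Phi f=0$ almost everywhere for every $f\in\mathrm{Dom}(H_\Phi)$. -/

import Mathlib

open MeasureTheory SchwartzMap
open scoped ENNReal NNReal ContDiff

noncomputable section

namespace HausdorffOp

/-- The Euclidean space `ℝⁿ`. -/
abbrev Rn (n : ℕ) : Type := EuclideanSpace ℝ (Fin n)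

variable {n : ℕ}

/-! ### Functions as tempered distributions -/

/-- The tempered distribution `u` is the locally integrable function `f`:
`⟨u, g⟩ = ∫ g f` for all `g ∈ C_c^∞(ℝⁿ)`. (As `C_c^∞` is dense in `𝓢`, such a `u` is unique.) -/
def Represents (f : Rn n → ℂ) (u : 𝓢'(Rn n, ℂ)) : Prop :=
  LocallyIntegrable f ∧
    ∀ g : 𝓢(Rn n, ℂ), HasCompactSupport g → u g = ∫ x, g x * f x

/-- The `L^p` (quasi-)norm of a tempered distribution; it is `∞` if `u` is not a locally
integrable function. (All functions representing `u` agree almost everywhere.) -/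
def distLpNorm (p : ℝ≥0∞) (u : 𝓢'(Rn n, ℂ)) : ℝ≥0∞ :=
  ⨅ (f : Rn n → ℂ) (_ : Represents f u), eLpNorm f p volume

/-- The `ℓ^q` (quasi-)norm, `0 < q ≤ ∞`, of a family in `[0, ∞]`. -/
def lqNorm {ι : Type} (q : ℝ≥0∞) (a : ι → ℝ≥0∞) : ℝ≥0∞ :=
  if q = ⊤ then ⨆ i, a i else (∑' i, a i ^ q.toReal) ^ (1 / q.toReal)

/-! ### Besov and Triebel-Lizorkin spaces -/

/-- A smooth bump function supported in `{|ξ| < 3/2}` and equal to `1` on `{|ξ| ≤ 4/3}`. -/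
structure IsDyadicBump (φ : Rn n → ℝ) : Prop where
  smooth : ContDiff ℝ ∞ φ
  support_subset : Function.support φ ⊆ Metric.ball 0 (3 / 2)
  eq_one : ∀ ξ, ‖ξ‖ ≤ 4 / 3 → φ ξ = 1

/-- The dyadic decomposition: `φ_0 = φ` and `φ_j(ξ) = φ(2^{-j} ξ) - φ(2 · 2^{-j} ξ)`, `j ≥ 1`. -/
def dyadicSymbol (φ : Rn n → ℝ) : ℕ → Rn n → ℝ
  | 0 => φ
  | j + 1 => fun ξ => φ (((2 : ℝ) ^ (j + 1))⁻¹ • ξ) - φ ((2 : ℝ) • ((2 : ℝ) ^ (j + 1))⁻¹ • ξ)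

/-- The Littlewood-Paley operator `Δ_j = 𝓕⁻¹ φ_j 𝓕` on tempered distributions. -/
def lpOp (φ : Rn n → ℝ) (j : ℕ) (u : 𝓢'(Rn n, ℂ)) : 𝓢'(Rn n, ℂ) :=
  TemperedDistribution.fourierMultiplierCLM ℂ (fun ξ => (dyadicSymbol φ j ξ : ℂ)) u

/-- The (quasi-)norm of `B_s^{p,q}`: the `ℓ^q` norm of `2^{js} ‖Δ_j u‖_{L^p}`. -/
def besovNorm (φ : Rn n → ℝ) (p q : ℝ≥0∞) (s : ℝ) (u : 𝓢'(Rn n, ℂ)) : ℝ≥0∞ :=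
  lqNorm q fun j : ℕ => (2 : ℝ≥0∞) ^ ((j : ℝ) * s) * distLpNorm p (lpOp φ j u)

/-- The (quasi-)norm of `F_s^{p,q}`: the `L^p` norm of the pointwise `ℓ^q` norm of
`2^{js} |Δ_j u|`. The infimum only serves to read `Δ_j u` as a function `g j`, which is unique up
to null sets. -/
def triebelLizorkinNorm (φ : Rn n → ℝ) (p q : ℝ≥0∞) (s : ℝ) (u : 𝓢'(Rn n, ℂ)) : ℝ≥0∞ :=
  ⨅ (g : ℕ → Rn n → ℂ) (_ : ∀ j, Represents (g j) (lpOp φ j u)),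
    eLpNorm (fun x => lqNorm q fun j : ℕ => (2 : ℝ≥0∞) ^ ((j : ℝ) * s) * ‖g j x‖ₑ) p volume

/-! ### Modulation spaces -/

/-- A smooth function with values in `[0, 1]`, equal to `1` for `|ξ|_∞ ≤ 1/2` and to `0` for
`|ξ|_∞ ≥ 3/4`. -/
structure IsUniformBump (η : Rn n → ℝ) : Prop where
  smooth : ContDiff ℝ ∞ η
  mem_Icc : ∀ ξ, η ξ ∈ Set.Icc (0 : ℝ) 1
  eq_one : ∀ ξ, (∀ i, |ξ i| ≤ 1 / 2) → η ξ = 1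
  eq_zero : ∀ ξ, (∃ i, 3 / 4 ≤ |ξ i|) → η ξ = 0

/-- The lattice point `k ∈ ℤⁿ` as a vector of `ℝⁿ`. -/
def latticePt (k : Fin n → ℤ) : Rn n := WithLp.toLp 2 fun i => (k i : ℝ)

/-- The uniform partition of unity `σ_k(ξ) = η(ξ - k) / ∑_l η(ξ - l)`. (The sum is locally
finite.) -/
def uniformSymbol (η : Rn n → ℝ) (k : Fin n → ℤ) (ξ : Rn n) : ℝ :=
  η (ξ - latticePt k) / ∑' l : Fin n → ℤ, η (ξ - latticePt l)

/-- The frequency-uniform decomposition operator `□_k = 𝓕⁻¹ σ_k 𝓕`. -/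
def boxOp (η : Rn n → ℝ) (k : Fin n → ℤ) (u : 𝓢'(Rn n, ℂ)) : 𝓢'(Rn n, ℂ) :=
  TemperedDistribution.fourierMultiplierCLM ℂ (fun ξ => (uniformSymbol η k ξ : ℂ)) u

/-- The (quasi-)norm of `M_s^{p,q}`: the `ℓ^q` norm of `⟨k⟩^s ‖□_k u‖_{L^p}`. -/
def modulationNorm (η : Rn n → ℝ) (p q : ℝ≥0∞) (s : ℝ) (u : 𝓢'(Rn n, ℂ)) : ℝ≥0∞ :=
  lqNorm q fun k : Fin n → ℤ =>
    ENNReal.ofReal ((1 + ‖latticePt k‖ ^ 2) ^ (s / 2)) * distLpNorm p (boxOp η k u)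

/-! ### Hausdorff operators -/

/-- `H_Φ f(x) = ∫ Φ(y) f(x / |y|) dy`. -/
def hausdorff (Φ f : Rn n → ℂ) (x : Rn n) : ℂ :=
  ∫ y, Φ y * f (‖y‖⁻¹ • x)

/-- The natural domain of `H_Φ`: the measurable `f` such that the integral defining `H_Φ f(x)`
converges absolutely for almost every `x`. -/
def hausdorffDomain (Φ : Rn n → ℂ) : Set (Rn n → ℂ) :=
  {f | AEStronglyMeasurable f volume ∧ ∀ᵐ x, Integrable fun y => Φ y * f (‖y‖⁻¹ • x)}

/-- `C_c^∞(ℝⁿ ∖ {0})`. -/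
def testAwayFromZero (n : ℕ) : Set (Rn n → ℂ) :=
  {f | ContDiff ℝ ∞ f ∧ HasCompactSupport f ∧ (0 : Rn n) ∉ tsupport f}

/-- `H_Φ`, with domain `𝒟`, is bounded on the space `X` of the tempered distributions whose
(quasi-)norm `N` is finite: `H_Φ f ∈ X` and `‖H_Φ f‖_X ≤ C ‖f‖_X` for all `f ∈ 𝒟 ∩ X`. -/
def IsBoundedOn (Φ : Rn n → ℂ) (𝒟 : Set (Rn n → ℂ)) (N : 𝓢'(Rn n, ℂ) → ℝ≥0∞) : Prop :=
  ∃ C : ℝ≥0, ∀ f ∈ 𝒟, ∀ u : 𝓢'(Rn n, ℂ), Represents f u → N u < ⊤ →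
    ∃ v : 𝓢'(Rn n, ℂ), Represents (hausdorff Φ f) v ∧ N v ≤ C * N u

/-- `H_Φ = 0`: `H_Φ f = 0` almost everywhere for every `f` in the natural domain of `H_Φ`. -/
def IsZeroOp (Φ : Rn n → ℂ) : Prop :=
  ∀ f ∈ hausdorffDomain Φ, ∀ᵐ x, hausdorff Φ f x = 0

end HausdorffOp

end

noncomputable section

open Filter Topology
open scoped FourierTransform Convolution

namespace HausdorffOp

variable {n : ℕ}

/-! ### Schwartz seminorms of products -/

/-! The proof has two halves: boundedness on `X` implies an `L^p` bound on smooth test functions,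
and for `p < 1` such a bound forces the operator to vanish.

First half. `H_Φ` commutes with the dilations `f ↦ f(·/t)` (`hausdorff_comp_smul`), whereas the norm
of `X` is inhomogeneous. As `t → ∞` the frequencies of `f(·/t)` concentrate at the origin, where a
single symbol of the decomposition equals 1; the other pieces are `O(t⁻¹)` with arbitrarily fast
decay in the frequency index, enough to beat the weights (`IsSymbolFamily.exists_pieces_le`). So the
norm of `f(·/t)` is at most a constant times an `L^p` norm that, normalized by `t^{-n/p}`, tends to
that of `f`. Conversely the norm of `X` dominates the `L^p` norm of the low-frequency piece, and the
low-frequency pieces of `(H_Φ f)(·/t)`, rescaled, converge pointwise to `H_Φ f` wherever it is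
continuous; Fatou's lemma concludes (`lintegral_le_liminf_of_represents`,
`exists_lintegral_hausdorff_le`). All three scales enter only through `IsAdmissibleNorm`.

Second half. In the variable `log ‖x‖`, `H_Φ` acts on radial functions as convolution on the line
with `A = radialDensity Φ` (`hausdorff_radialTest`). For an approximate identity of width `ε`, the
convolutions tend to `A` almost everywhere, while the integral of the `p`-th power of the bump is
`O(ε^{1-p})` and tends to 0. Hence `A = 0` (`isZeroOp_of_lintegral_le`). Every value `H_Φ f(x)`, for
`f` radial or not, depends on `Φ` only through `A`, so `H_Φ = 0`. -/

theorem exists_seminorm_smulLeftCLM_le (f : 𝓢(Rn n, ℂ)) (k l P : ℕ) :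
    ∃ C : ℝ, 0 ≤ C ∧ ∀ μ : Rn n → ℂ, μ.HasTemperateGrowth → ∀ ε : ℝ, 0 ≤ ε →
      (∀ j ≤ l, ∀ ξ, ‖iteratedFDeriv ℝ j μ ξ‖ ≤ ε * (1 + ‖ξ‖) ^ P) →
      SchwartzMap.seminorm ℂ k l (smulLeftCLM ℂ μ f) ≤ C * ε := by
  -- The growth `(1 + ‖ξ‖)^P` of the symbol is paid for by `P` extra weights on `f`, hence the index
  -- `k + P`.
  set S := (Finset.Iic (k + P, l)).sup (fun m => SchwartzMap.seminorm ℂ m.1 m.2) f with hS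
  have hS0 : 0 ≤ S := apply_nonneg _ _
  refine ⟨2 ^ l * (2 ^ (k + P) * S), by positivity, fun μ hμ ε hε hb => ?_⟩
  refine SchwartzMap.seminorm_le_bound ℂ k l _ (by positivity) fun ξ => ?_
  have h1 : ‖iteratedFDeriv ℝ l (smulLeftCLM ℂ μ f) ξ‖ ≤
      ∑ i ∈ Finset.range (l + 1), (l.choose i : ℝ) * ‖iteratedFDeriv ℝ i μ ξ‖ *
        ‖iteratedFDeriv ℝ (l - i) f ξ‖ := by
    rw [smulLeftCLM_apply hμ]
    exact norm_iteratedFDeriv_mul_le (n := l) (N := ∞) hμ.1 (f.smooth ⊤) ξ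
      (by exact_mod_cast le_top)
  have h2 : ∀ i ∈ Finset.range (l + 1), ‖ξ‖ ^ k * ((l.choose i : ℝ) * ‖iteratedFDeriv ℝ i μ ξ‖ *
        ‖iteratedFDeriv ℝ (l - i) f ξ‖) ≤ (l.choose i : ℝ) * (2 ^ (k + P) * S * ε) := by
    intro i hi
    have hi' : i ≤ l := Nat.lt_succ_iff.mp (Finset.mem_range.mp hi)
    have h3 := SchwartzMap.one_add_le_sup_seminorm_apply (𝕜 := ℂ) (m := (k + P, l)) (k := k + P)
      (n := l - i) le_rfl (Nat.sub_le _ _) f ξ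
    have h4 : ‖ξ‖ ^ k ≤ (1 + ‖ξ‖) ^ k := by gcongr; linarith
    calc _ ≤ (1 + ‖ξ‖) ^ k * ((l.choose i : ℝ) * (ε * (1 + ‖ξ‖) ^ P) *
        ‖iteratedFDeriv ℝ (l - i) f ξ‖) := by gcongr; exact hb i hi' ξ
      _ = (l.choose i : ℝ) * (((1 + ‖ξ‖) ^ (k + P) * ‖iteratedFDeriv ℝ (l - i) f ξ‖) * ε) := by
        rw [pow_add]; ring
      _ ≤ _ := by gcongr
  refine (mul_le_mul_of_nonneg_left h1 (by positivity)).trans ?_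
  rw [Finset.mul_sum]
  calc _ ≤ ∑ i ∈ Finset.range (l + 1), (l.choose i : ℝ) * (2 ^ (k + P) * S * ε) :=
        Finset.sum_le_sum h2
    _ = 2 ^ l * (2 ^ (k + P) * S) * ε := by
      rw [← Finset.sum_mul, ← Nat.cast_sum, Nat.sum_range_choose]; push_cast; ring

/-- Multiplying a Schwartz function by a small symbol of controlled growth gives a small Schwartz
function. -/
theorem exists_continuous_seminorm_smulLeftCLM_le (Q : Seminorm ℂ 𝓢(Rn n, ℂ)) (hQ : Continuous Q)
    (f : 𝓢(Rn n, ℂ)) (P : ℕ) (K : ℕ → ℝ) :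
    ∃ C : ℝ, 0 ≤ C ∧ ∀ μ : Rn n → ℂ, μ.HasTemperateGrowth → ∀ ε : ℝ, 0 ≤ ε →
      (∀ j ξ, ‖iteratedFDeriv ℝ j μ ξ‖ ≤ ε * K j * (1 + ‖ξ‖) ^ P) →
      Q (smulLeftCLM ℂ μ f) ≤ C * ε := by
  obtain ⟨s, C, -, hC⟩ := Seminorm.bound_of_continuous (schwartz_withSeminorms ℂ (Rn n) ℂ) Q hQ
  choose D hD0 hD using fun i : ℕ × ℕ => exists_seminorm_smulLeftCLM_le f i.1 i.2 P
  let T : ℕ × ℕ → ℝ := fun i => D i * ∑ j ∈ Finset.range (i.2 + 1), |K j|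
  have hT : ∀ i, 0 ≤ T i := fun i =>
    mul_nonneg (hD0 i) (Finset.sum_nonneg fun j _ => abs_nonneg _)
  have hTs : 0 ≤ ∑ i ∈ s, T i := Finset.sum_nonneg fun i _ => hT i
  refine ⟨C * ∑ i ∈ s, T i, by positivity, fun μ hμ ε hε hb => ?_⟩
  refine (hC _).trans ?_
  rw [_root_.smul_apply, NNReal.smul_def, smul_eq_mul, mul_assoc]
  gcongr
  refine Seminorm.finset_sup_apply_le (by positivity) fun i hi => ?_
  have h1 := hD i μ hμ (ε * ∑ j ∈ Finset.range (i.2 + 1), |K j|)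
    (mul_nonneg hε (Finset.sum_nonneg fun j _ => abs_nonneg _)) fun j hj ξ => by
      refine (hb j ξ).trans ?_
      gcongr
      exact (le_abs_self _).trans (Finset.single_le_sum (f := fun j => |K j|)
        (fun j _ => abs_nonneg _) (Finset.mem_range.mpr (Nat.lt_succ_of_le hj)))
  refine h1.trans ?_
  calc _ = T i * ε := by simp only [T]; ring
    _ ≤ _ := by
      gcongr
      exact Finset.single_le_sum (f := T) (fun j _ => hT j) hi

/-- The part of a Schwartz function outside a large ball is small. -/
theorem exists_continuous_seminorm_smulLeftCLM_le_of_vanish (Q : Seminorm ℂ 𝓢(Rn n, ℂ))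
    (hQ : Continuous Q) (f : 𝓢(Rn n, ℂ)) (P : ℕ) (K : ℕ → ℝ) :
    ∃ C : ℝ, 0 ≤ C ∧ ∀ μ : Rn n → ℂ, μ.HasTemperateGrowth → ∀ ρ : ℝ, 0 < ρ →
      (∀ j ξ, ‖iteratedFDeriv ℝ j μ ξ‖ ≤ K j) → (∀ ξ, ‖ξ‖ < ρ → μ ξ = 0) →
      Q (smulLeftCLM ℂ μ f) ≤ C * ρ⁻¹ ^ P := by
  obtain ⟨C, hC0, hC⟩ := exists_continuous_seminorm_smulLeftCLM_le Q hQ f P K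
  refine ⟨C, hC0, fun μ hμ ρ hρ hK hv => hC μ hμ _ (by positivity) fun j ξ => ?_⟩
  have hK0 : 0 ≤ K j := (norm_nonneg _).trans (hK j ξ)
  by_cases h : ‖ξ‖ < ρ
  · have h0 : μ =ᶠ[𝓝 ξ] fun _ => (0 : ℂ) := by
      filter_upwards [(isOpen_lt continuous_norm continuous_const).mem_nhds h] with y hy
      exact hv y hy
    rw [(h0.iteratedFDeriv ℝ j).self_of_nhds]
    have : iteratedFDeriv ℝ j (fun _ : Rn n => (0 : ℂ)) ξ = 0 := by
      simp
    rw [this, norm_zero]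
    positivity
  · push Not at h
    -- Outside the ball this factor is at least 1, so any power of `ρ⁻¹` can be bought with
    -- polynomial growth in `ξ`, which the Schwartz function absorbs.
    have h1 : 1 ≤ (ρ⁻¹ * (1 + ‖ξ‖)) ^ P := by
      refine one_le_pow₀ ?_
      rw [inv_mul_eq_div, one_le_div hρ]; linarith
    calc _ ≤ K j * 1 := by simpa using hK j ξ
      _ ≤ K j * (ρ⁻¹ * (1 + ‖ξ‖)) ^ P := by gcongr
      _ = _ := by rw [mul_pow]; ring

theorem tendsto_zero_of_seminorm {α : Type*} {l : Filter α} {F : α → 𝓢(Rn n, ℂ)}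
    (h : ∀ k m : ℕ, Tendsto (fun a => SchwartzMap.seminorm ℂ k m (F a)) l (𝓝 0)) :
    Tendsto F l (𝓝 0) := by
  rw [(schwartz_withSeminorms ℂ (Rn n) ℂ).tendsto_nhds]
  intro i ε hε
  simpa using! (h i.1 i.2).eventually (gt_mem_nhds hε)

theorem continuous_seminorm (k l : ℕ) :
    Continuous (SchwartzMap.seminorm ℂ k l : Seminorm ℂ 𝓢(Rn n, ℂ)) :=
  (schwartz_withSeminorms ℂ (Rn n) ℂ).continuous_seminorm (k, l)

theorem hasTemperateGrowth_of_bounded {μ : Rn n → ℂ} (hμ : ContDiff ℝ ∞ μ) {K : ℕ → ℝ}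
    (hK : ∀ j ξ, ‖iteratedFDeriv ℝ j μ ξ‖ ≤ K j) : μ.HasTemperateGrowth :=
  ⟨hμ, fun j => ⟨0, K j, fun ξ => by simpa using hK j ξ⟩⟩

theorem exists_bound_iteratedFDeriv {μ : Rn n → ℂ} (hμ : ContDiff ℝ ∞ μ)
    (hc : HasCompactSupport μ) : ∃ K : ℕ → ℝ, ∀ j ξ, ‖iteratedFDeriv ℝ j μ ξ‖ ≤ K j := by
  have h := fun j => (hc.toSchwartzMap hμ).decay 0 j
  choose K _ hK using h
  exact ⟨K, fun j ξ => by simpa using! hK j ξ⟩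

/-! ### Dilations -/

/-- The dilation `f ↦ f(c ·)` of Schwartz functions, for `c ≠ 0`. -/
def dil (c : ℝ) : 𝓢(Rn n, ℂ) →L[ℂ] 𝓢(Rn n, ℂ) :=
  if hc : c = 0 then 0 else
    compCLMOfContinuousLinearEquiv ℂ (ContinuousLinearEquiv.smulLeft (Units.mk0 c hc))

theorem dil_apply {c : ℝ} (hc : c ≠ 0) (f : 𝓢(Rn n, ℂ)) (x : Rn n) : dil c f x = f (c • x) := by
  simp only [dil, hc, dite_false]
  rfl

theorem coe_dil {c : ℝ} (hc : c ≠ 0) (f : 𝓢(Rn n, ℂ)) : ⇑(dil c f) = fun x => f (c • x) :=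
  funext (dil_apply hc f)

theorem seminorm_dil_le {t : ℝ} (ht : 1 ≤ t) (k l : ℕ) (f : 𝓢(Rn n, ℂ)) :
    SchwartzMap.seminorm ℂ k l (dil t f) ≤ t ^ l * SchwartzMap.seminorm ℂ k l f := by
  have ht0 : 0 < t := by linarith
  refine SchwartzMap.seminorm_le_bound ℂ k l _ (by positivity) fun x => ?_
  rw [coe_dil ht0.ne', iteratedFDeriv_comp_const_smul t (f.smooth l), norm_smul, norm_pow,
    Real.norm_of_nonneg ht0.le]
  have h1 := SchwartzMap.le_seminorm ℂ k l f (t • x)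
  have h2 : ‖x‖ ≤ ‖t • x‖ := by
    rw [norm_smul, Real.norm_of_nonneg ht0.le]
    nlinarith [norm_nonneg x]
  calc _ ≤ ‖t • x‖ ^ k * (t ^ l * ‖iteratedFDeriv ℝ l f (t • x)‖) := by gcongr
    _ = t ^ l * (‖t • x‖ ^ k * ‖iteratedFDeriv ℝ l f (t • x)‖) := by ring
    _ ≤ _ := by gcongr

theorem integral_comp_smul_rn {c : ℝ} (hc : 0 < c) (f : Rn n → ℂ) :
    ∫ x, f (c • x) = ((c : ℂ) ^ n)⁻¹ * ∫ x, f x := by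
  rw [Measure.integral_comp_smul, finrank_euclideanSpace_fin, abs_of_pos (by positivity),
    Complex.real_smul]
  push_cast
  rfl

theorem fourier_dil {c : ℝ} (hc : 0 < c) (f : 𝓢(Rn n, ℂ)) (ξ : Rn n) :
    𝓕 (dil c f) ξ = ((c : ℂ) ^ n)⁻¹ * 𝓕 f (c⁻¹ • ξ) := by
  rw [fourier_coe, fourier_coe, Real.fourier_eq, Real.fourier_eq, ← integral_comp_smul_rn hc]
  congr 1 with v
  rw [dil_apply hc.ne', inner_smul_left, inner_smul_right]
  congr 4
  simp [hc.ne']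

theorem fourierInv_dil {c : ℝ} (hc : 0 < c) (f : 𝓢(Rn n, ℂ)) (ξ : Rn n) :
    𝓕⁻ (dil c f) ξ = ((c : ℂ) ^ n)⁻¹ * 𝓕⁻ f (c⁻¹ • ξ) := by
  rw [fourierInv_coe, fourierInv_coe, Real.fourierInv_eq, Real.fourierInv_eq,
    ← integral_comp_smul_rn hc]
  congr 1 with v
  rw [dil_apply hc.ne', inner_smul_left, inner_smul_right]
  congr 3
  simp [hc.ne']

theorem hasTemperateGrowth_comp_smul {m : Rn n → ℂ} (hm : m.HasTemperateGrowth) (c : ℝ) :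
    (fun ξ => m (c • ξ)).HasTemperateGrowth :=
  hm.comp (g := m) (f := fun ξ : Rn n => c • ξ) (by fun_prop)

/-- Moves a dilation from the function to the symbol. With `c = t⁻¹` the symbol is stretched, so a
symbol vanishing near the origin comes to vanish on a ball of radius comparable to `t`. -/
theorem fourierMultiplierCLM_dil {c : ℝ} (hc : 0 < c) {m : Rn n → ℂ} (hm : m.HasTemperateGrowth)
    (f : 𝓢(Rn n, ℂ)) :
    SchwartzMap.fourierMultiplierCLM ℂ m (dil c f) =
      dil c (SchwartzMap.fourierMultiplierCLM ℂ (fun ξ => m (c • ξ)) f) := by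
  have hm' := hasTemperateGrowth_comp_smul hm c
  have h : smulLeftCLM ℂ m (𝓕 (dil c f)) =
      ((c : ℂ) ^ n)⁻¹ • dil c⁻¹ (smulLeftCLM ℂ (fun ξ => m (c • ξ)) (𝓕 f)) := by
    ext ξ
    rw [smulLeftCLM_apply_apply hm, fourier_dil hc, smul_apply, dil_apply (inv_ne_zero hc.ne'),
      smulLeftCLM_apply_apply hm', smul_inv_smul₀ hc.ne', smul_eq_mul, smul_eq_mul, smul_eq_mul]
    ring
  rw [SchwartzMap.fourierMultiplierCLM_apply, SchwartzMap.fourierMultiplierCLM_apply, h]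
  ext x
  rw [FourierTransform.fourierInv_smul, smul_apply, fourierInv_dil (inv_pos.mpr hc), inv_inv,
    dil_apply hc.ne', smul_eq_mul]
  have : (c : ℂ) ≠ 0 := by exact_mod_cast hc.ne'
  push_cast
  rw [inv_pow, inv_inv, ← mul_assoc, inv_mul_cancel₀ (pow_ne_zero _ this), one_mul]

/-! ### Translations -/

theorem fourierInv_compSubConst (x : Rn n) (f : 𝓢(Rn n, ℂ)) (ξ : Rn n) :
    𝓕⁻ (compSubConstCLM ℂ x f) ξ = (Real.fourierChar (inner ℝ x ξ) : ℂ) * 𝓕⁻ f ξ := by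
  rw [fourierInv_coe, fourierInv_coe, Real.fourierInv_eq, Real.fourierInv_eq, ← integral_const_mul,
    ← integral_add_right_eq_self _ x]
  congr 1 with v
  rw [compSubConstCLM_apply, add_sub_cancel_right, inner_add_left, Circle.smul_def,
    Circle.smul_def, AddChar.map_add_eq_mul, Circle.coe_mul, smul_eq_mul, smul_eq_mul]
  ring

theorem fourier_eq_compSubConst (x : Rn n) {f g : 𝓢(Rn n, ℂ)}
    (h : ∀ ξ, g ξ = (Real.fourierChar (inner ℝ x ξ) : ℂ) * f ξ) :
    𝓕 g = compSubConstCLM ℂ x (𝓕 f) := by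
  ext y
  rw [compSubConstCLM_apply, fourier_coe, fourier_coe, Real.fourier_eq, Real.fourier_eq]
  congr 1 with v
  rw [h, Circle.smul_def, Circle.smul_def, smul_eq_mul, smul_eq_mul, ← mul_assoc, ← Circle.coe_mul,
    ← AddChar.map_add_eq_mul]
  congr 4
  rw [inner_sub_right, real_inner_comm x v]
  ring

/-- Fourier multipliers commute with translations. The order `𝓕`, symbol, `𝓕⁻` is that of the
transposed multiplier, which acts on the test functions of a distribution. -/
theorem fourier_smulLeft_fourierInv_compSubConst {m : Rn n → ℂ} (hm : m.HasTemperateGrowth)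
    (x : Rn n) (f : 𝓢(Rn n, ℂ)) :
    𝓕 (smulLeftCLM ℂ m (𝓕⁻ (compSubConstCLM ℂ x f))) =
      compSubConstCLM ℂ x (𝓕 (smulLeftCLM ℂ m (𝓕⁻ f))) := by
  refine fourier_eq_compSubConst x fun ξ => ?_
  rw [smulLeftCLM_apply_apply hm, smulLeftCLM_apply_apply hm, fourierInv_compSubConst, smul_eq_mul,
    smul_eq_mul]
  ring

/-! ### Approximation in the Schwartz space -/

/-- The symbol `b(ξ/(N+1)) - b(0)` and its derivatives are `O((N+1)⁻¹ (1 + ‖ξ‖))`: by the mean value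
inequality at order 0, by the chain rule at higher orders. It serves both with `b` a cutoff (density
of compact supports) and with `b` the transform of a mollifier. -/
theorem tendsto_smulLeftCLM_comp_smul (b m : 𝓢(Rn n, ℂ)) :
    Tendsto (fun N : ℕ => smulLeftCLM ℂ (fun ξ => b (((N : ℝ) + 1)⁻¹ • ξ)) m) atTop
      (𝓝 (b 0 • m)) := by
  have hb : ∀ N : ℕ, (fun ξ => b (((N : ℝ) + 1)⁻¹ • ξ)).HasTemperateGrowth := fun N =>
    hasTemperateGrowth_comp_smul b.hasTemperateGrowth _
  let μ : ℕ → Rn n → ℂ := fun N ξ => b (((N : ℝ) + 1)⁻¹ • ξ) - b 0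
  have hμ : ∀ N, (μ N).HasTemperateGrowth := fun N =>
    (hb N).sub (Function.HasTemperateGrowth.const (b 0))
  have heq : ∀ N : ℕ, smulLeftCLM ℂ (fun ξ => b (((N : ℝ) + 1)⁻¹ • ξ)) m =
      smulLeftCLM ℂ (μ N) m + b 0 • m := by
    intro N
    ext ξ
    rw [add_apply, smulLeftCLM_apply_apply (hb N), smulLeftCLM_apply_apply (hμ N),
      smul_apply]
    simp only [μ, smul_eq_mul]
    ring
  let K : ℕ → ℝ := fun j => SchwartzMap.seminorm ℂ 0 j b + SchwartzMap.seminorm ℂ 0 1 b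
  have hK1 : ∀ j : ℕ, 0 ≤ SchwartzMap.seminorm ℂ 0 j b := fun j => apply_nonneg _ _
  have hbound : ∀ (N : ℕ) j ξ, ‖iteratedFDeriv ℝ j (μ N) ξ‖ ≤
      ((N : ℝ) + 1)⁻¹ * K j * (1 + ‖ξ‖) ^ 1 := by
    intro N j ξ
    have hN : (0 : ℝ) < ((N : ℝ) + 1)⁻¹ := by positivity
    have hN1 : ((N : ℝ) + 1)⁻¹ ≤ 1 := inv_le_one_of_one_le₀ (by linarith [N.cast_nonneg (α := ℝ)])
    rcases Nat.eq_zero_or_pos j with rfl | hj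
    · rw [norm_iteratedFDeriv_zero]
      have h1 := Convex.norm_image_sub_le_of_norm_fderiv_le (𝕜 := ℝ) (f := b)
        (C := SchwartzMap.seminorm ℂ 0 1 b) (s := Set.univ) (x := 0) (y := ((N : ℝ) + 1)⁻¹ • ξ)
        (fun x _ => b.differentiableAt) (fun x _ => by
          rw [← norm_iteratedFDeriv_one]
          exact b.norm_iteratedFDeriv_le_seminorm ℂ 1 x) convex_univ trivial trivial
      rw [sub_zero, norm_smul, Real.norm_of_nonneg hN.le] at h1
      calc _ ≤ _ := h1
        _ = ((N : ℝ) + 1)⁻¹ * SchwartzMap.seminorm ℂ 0 1 b * ‖ξ‖ := by ring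
        _ ≤ _ := by
          have h9 : SchwartzMap.seminorm ℂ 0 1 b ≤ K 0 := le_add_of_nonneg_left (hK1 0)
          have h10 : 0 ≤ K 0 := (hK1 1).trans h9
          rw [pow_one]
          gcongr
          linarith
    · have h2 : iteratedFDeriv ℝ j (μ N) ξ =
          ((N : ℝ) + 1)⁻¹ ^ j • iteratedFDeriv ℝ j b (((N : ℝ) + 1)⁻¹ • ξ) := by
        have h3 : iteratedFDeriv ℝ j (fun _ : Rn n => b 0) ξ = 0 := by
          rw [iteratedFDeriv_const_of_ne hj.ne']; rfl
        have h4 := congrFun (iteratedFDeriv_comp_const_smul ((N : ℝ) + 1)⁻¹ (b.smooth j)) ξ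
        rw [← h4]
        have h5 : (μ N) = (fun ξ => b (((N : ℝ) + 1)⁻¹ • ξ)) - fun _ => b 0 := rfl
        rw [h5, iteratedFDeriv_sub_apply, h3, sub_zero]
        · exact ((hb N).1.of_le (by exact_mod_cast le_top)).contDiffAt
        · exact contDiffAt_const
      rw [h2, norm_smul, norm_pow, Real.norm_of_nonneg hN.le]
      have h6 := b.norm_iteratedFDeriv_le_seminorm ℂ j (((N : ℝ) + 1)⁻¹ • ξ)
      have h7 : ((N : ℝ) + 1)⁻¹ ^ j ≤ ((N : ℝ) + 1)⁻¹ :=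
        pow_le_of_le_one hN.le hN1 hj.ne'
      have h8 : 0 ≤ K j := add_nonneg (hK1 _) (hK1 _)
      calc _ ≤ ((N : ℝ) + 1)⁻¹ * K j := by
            gcongr
            exact h6.trans (by simp only [K]; linarith [hK1 1])
        _ ≤ _ := le_mul_of_one_le_right (by positivity) (by simp)
  have hlim : Tendsto (fun N : ℕ => smulLeftCLM ℂ (μ N) m) atTop (𝓝 0) := by
    refine tendsto_zero_of_seminorm fun k l => ?_
    obtain ⟨C, hC0, hC⟩ := exists_continuous_seminorm_smulLeftCLM_le
      (SchwartzMap.seminorm ℂ k l) (continuous_seminorm k l) m 1 K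
    refine squeeze_zero (fun N => apply_nonneg _ _)
      (fun N => hC (μ N) (hμ N) ((N : ℝ) + 1)⁻¹ (by positivity) (hbound N)) ?_
    simpa using (tendsto_one_div_add_atTop_nhds_zero_nat (𝕜 := ℝ)).const_mul C
  simp_rw [heq]
  simpa using hlim.add_const (b 0 • m)

/-- A bump function around `x` of radii `r` and `2 r`. -/
def bumpAt (x : Rn n) (r : ℝ) (hr : 0 < r) : ContDiffBump x := ⟨r, 2 * r, hr, by linarith⟩

/-- The Schwartz function given by a complex multiple of a bump function. -/
def bumpSchwartz {x : Rn n} (f : ContDiffBump x) (c : ℂ) : 𝓢(Rn n, ℂ) :=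
  HasCompactSupport.toSchwartzMap (f := fun y => c * (f y : ℂ))
    (HasCompactSupport.mul_left (f' := fun y => (f y : ℂ))
      (f.hasCompactSupport.comp_left (g := fun r : ℝ => (r : ℂ)) Complex.ofReal_zero))
    (contDiff_const.mul (Complex.ofRealCLM.contDiff.comp f.contDiff))

theorem bumpSchwartz_apply {x : Rn n} (f : ContDiffBump x) (c : ℂ) (y : Rn n) :
    bumpSchwartz f c y = c * f y := rfl

theorem hasCompactSupport_bumpSchwartz {x : Rn n} (f : ContDiffBump x) (c : ℂ) :
    HasCompactSupport (bumpSchwartz f c) :=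
  HasCompactSupport.mul_left (f' := fun y => (f y : ℂ))
    (f.hasCompactSupport.comp_left (g := fun r : ℝ => (r : ℂ)) Complex.ofReal_zero)

/-- Compactly supported functions are dense in the Schwartz space. -/
theorem eq_of_eq_of_hasCompactSupport {A B : 𝓢(Rn n, ℂ) → ℂ} (hA : Continuous A)
    (hB : Continuous B) (h : ∀ g : 𝓢(Rn n, ℂ), HasCompactSupport g → A g = B g) : A = B := by
  funext m
  let b : 𝓢(Rn n, ℂ) := bumpSchwartz (bumpAt (0 : Rn n) 1 one_pos) 1
  have hb0 : b 0 = 1 := by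
    have : (bumpAt (0 : Rn n) 1 one_pos) 0 = 1 :=
      ContDiffBump.one_of_mem_closedBall _ (by simp [bumpAt])
    simp [b, bumpSchwartz_apply, this]
  have hlim := tendsto_smulLeftCLM_comp_smul b m
  rw [hb0, one_smul] at hlim
  refine tendsto_nhds_unique ((hA.tendsto m).comp hlim)
    (((hB.tendsto m).comp hlim).congr fun N => ?_)
  refine (h _ ?_).symm
  rw [smulLeftCLM_apply (hasTemperateGrowth_comp_smul b.hasTemperateGrowth _)]
  refine HasCompactSupport.mul_right (f := fun ξ => b (((N : ℝ) + 1)⁻¹ • ξ)) ?_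
  exact (hasCompactSupport_bumpSchwartz _ _).comp_smul (by positivity)

/-- `Represents` permits the change of variables only against compactly supported functions; density
extends it to every `ψ`. This is needed for translates of `𝓕 m`, whose support need not be compact.
-/
theorem Represents.apply_of_comp_smul {g : Rn n → ℂ} {v w : 𝓢'(Rn n, ℂ)} (hv : Represents g v)
    {t : ℝ} (ht : 0 < t) (hw : Represents (fun x => g (t⁻¹ • x)) w) (ψ : 𝓢(Rn n, ℂ)) :
    w ψ = (t : ℂ) ^ n * v (dil t ψ) := by
  refine congrFun (eq_of_eq_of_hasCompactSupport (A := fun ψ => w ψ)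
    (B := fun ψ => (t : ℂ) ^ n * v (dil t ψ)) (map_continuous w)
    (continuous_const.mul ((map_continuous v).comp (dil t).continuous)) fun h hh => ?_) ψ
  have hc : HasCompactSupport (dil t h) := by
    rw [coe_dil ht.ne']; exact hh.comp_smul ht.ne'
  have h1 : ∀ x, dil t h x * g x = (fun y => h y * g (t⁻¹ • y)) (t • x) := fun x => by
    simp [dil_apply ht.ne', ht.ne']
  rw [hw.2 h hh, hv.2 _ hc]
  simp_rw [h1]
  rw [integral_comp_smul_rn ht (fun y => h y * g (t⁻¹ • y)), ← mul_assoc, mul_inv_cancel₀, one_mul]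
  exact pow_ne_zero _ (by exact_mod_cast ne_of_gt ht)

/-! ### Pointwise values of frequency-localized distributions -/

/-- If `m` is a Schwartz function, then `m(D) u` is the function `x ↦ ⟨u, (𝓕 m)(· - x)⟩`. -/
theorem ae_eq_of_represents_fourierMultiplier (m : 𝓢(Rn n, ℂ)) (u : 𝓢'(Rn n, ℂ)) {F : Rn n → ℂ}
    (hF : Represents F (TemperedDistribution.fourierMultiplierCLM ℂ (fun ξ => m ξ) u)) :
    ∀ᵐ x, F x = u (compSubConstCLM ℂ x (𝓕 m)) := by
  have hr : ∀ N : ℕ, (0 : ℝ) < ((N : ℝ) + 1)⁻¹ := fun N => by positivity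
  -- The mollifiers are dilates of a single bump, so their inverse Fourier transforms are dilates of
  -- a single function with value 1 at the origin.
  let β : ℕ → ContDiffBump (0 : Rn n) := fun N => bumpAt 0 ((N : ℝ) + 1)⁻¹ (hr N)
  let β₀ : ContDiffBump (0 : Rn n) := bumpAt 0 1 one_pos
  have hβ : ∀ N y, β N y = β₀ (((N : ℝ) + 1) • y) := by
    intro N y
    have h2 : 2 * ((N : ℝ) + 1)⁻¹ * ((N : ℝ) + 1) = 2 := by
      rw [mul_assoc, inv_mul_cancel₀ (by positivity), mul_one]
    simp [β, β₀, bumpAt, ContDiffBump.apply, h2]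
  let I₀ : ℝ := ∫ y, β₀ y
  have hI₀ : 0 < I₀ := β₀.integral_pos
  let h₀ : 𝓢(Rn n, ℂ) := bumpSchwartz β₀ (I₀ : ℂ)⁻¹
  let h : ℕ → 𝓢(Rn n, ℂ) := fun N => ((N : ℂ) + 1) ^ n • dil ((N : ℝ) + 1) h₀
  have hN0 : ∀ N : ℕ, (0 : ℝ) < (N : ℝ) + 1 := fun N => by positivity
  have hnormed : ∀ N y, (((β N).normed volume y : ℝ) : ℂ) = h N y := by
    intro N y
    have hI : ∫ y, β N y = (((N : ℝ) + 1) ^ n)⁻¹ * I₀ := by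
      simp_rw [hβ]
      rw [Measure.integral_comp_smul, finrank_euclideanSpace_fin,
        abs_of_pos (by have := hN0 N; positivity), smul_eq_mul]
    simp only [h]
    rw [ContDiffBump.normed_def, hI, hβ, smul_apply, dil_apply (hN0 N).ne', bumpSchwartz_apply]
    have : ((N : ℂ) + 1) ≠ 0 := by exact_mod_cast (hN0 N).ne'
    have : (I₀ : ℂ) ≠ 0 := by exact_mod_cast hI₀.ne'
    push_cast
    rw [smul_eq_mul]
    field_simp
  have hcs : ∀ N x, HasCompactSupport (compSubConstCLM ℂ x (h N)) := by
    intro N x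
    have h1 : HasCompactSupport (h N) := by
      have : ⇑(h N) = fun y => (((β N).normed volume y : ℝ) : ℂ) :=
        funext fun y => (hnormed N y).symm
      rw [this]
      exact ((β N).hasCompactSupport_normed).comp_left (g := fun r : ℝ => (r : ℂ))
        Complex.ofReal_zero
    exact h1.comp_homeomorph (Homeomorph.subRight x)
  -- Mollifying `F` amounts to testing the distribution against translated mollifiers; by duality
  -- the mollifier ends up as a factor on the symbol `m`, where it tends to 1.
  have hconv : ∀ N x, (((β N).normed volume ⋆[ContinuousLinearMap.lsmul ℝ ℝ, volume] F) x) =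
      u (compSubConstCLM ℂ x (𝓕 (smulLeftCLM ℂ (fun ξ => m ξ) (𝓕⁻ (h N))))) := by
    intro N x
    rw [← fourier_smulLeft_fourierInv_compSubConst m.hasTemperateGrowth,
      ← TemperedDistribution.fourierMultiplierCLM_apply_apply, hF.2 _ (hcs N x),
      convolution_eq_swap]
    congr 1 with y
    rw [compSubConstCLM_apply, ← hnormed, ContinuousLinearMap.lsmul_apply, Complex.real_smul,
      ← (β N).normed_neg, neg_sub]
  have hb : ∀ N ξ, 𝓕⁻ (h N) ξ = 𝓕⁻ h₀ (((N : ℝ) + 1)⁻¹ • ξ) := by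
    intro N ξ
    simp only [h]
    rw [FourierTransform.fourierInv_smul, smul_apply, fourierInv_dil (hN0 N), smul_eq_mul,
      ← mul_assoc]
    have : ((N : ℂ) + 1) ≠ 0 := by exact_mod_cast (hN0 N).ne'
    push_cast
    rw [mul_inv_cancel₀ (pow_ne_zero _ this), one_mul]
  have hb0 : 𝓕⁻ h₀ 0 = 1 := by
    rw [fourierInv_coe, Real.fourierInv_eq]
    simp only [inner_zero_right, AddChar.map_zero_eq_one, one_smul]
    have : (fun v => h₀ v) = fun v => (I₀ : ℂ)⁻¹ * ((β₀ v : ℝ) : ℂ) := rfl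
    rw [this, integral_const_mul, integral_complex_ofReal]
    exact inv_mul_cancel₀ (by exact_mod_cast hI₀.ne')
  have hlim : Tendsto (fun N => smulLeftCLM ℂ (fun ξ => m ξ) (𝓕⁻ (h N))) atTop (𝓝 m) := by
    have h1 := tendsto_smulLeftCLM_comp_smul (𝓕⁻ h₀) m
    rw [hb0, one_smul] at h1
    refine h1.congr fun N => ?_
    ext ξ
    rw [smulLeftCLM_apply_apply m.hasTemperateGrowth, smulLeftCLM_apply_apply
      (hasTemperateGrowth_comp_smul (𝓕⁻ h₀).hasTemperateGrowth _), hb, smul_eq_mul, smul_eq_mul,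
      mul_comm]
  have hrad : Tendsto (fun N => (β N).rOut) atTop (𝓝 0) := by
    simpa [β, bumpAt] using (tendsto_one_div_add_atTop_nhds_zero_nat (𝕜 := ℝ)).const_mul 2
  -- Lebesgue differentiation; `K = 2` is the ratio of outer to inner radius in `bumpAt`.
  filter_upwards [ContDiffBump.ae_convolution_tendsto_right_of_locallyIntegrable (K := 2) hrad
    (Eventually.of_forall fun N => le_rfl) hF.1] with x hx
  refine tendsto_nhds_unique hx ?_
  simp_rw [hconv]
  have h2 : Continuous fun ψ : 𝓢(Rn n, ℂ) => u (compSubConstCLM ℂ x (𝓕 ψ)) :=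
    (map_continuous u).comp ((compSubConstCLM ℂ x).continuous.comp
      (FourierTransform.continuous_fourier (E := 𝓢(Rn n, ℂ))))
  exact (h2.tendsto m).comp hlim

/-! ### Bounds for dilated symbols -/

theorem norm_iteratedFDeriv_comp_smul_le {b : Rn n → ℂ} (hb : ContDiff ℝ ∞ b) {K : ℕ → ℝ}
    (hK : ∀ j ξ, ‖iteratedFDeriv ℝ j b ξ‖ ≤ K j) {c : ℝ} (hc0 : 0 ≤ c) (hc1 : c ≤ 1) (j : ℕ)
    (ξ : Rn n) : ‖iteratedFDeriv ℝ j (fun ξ => b (c • ξ)) ξ‖ ≤ K j := by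
  rw [iteratedFDeriv_comp_const_smul c (hb.of_le (by exact_mod_cast le_top)), norm_smul, norm_pow,
    Real.norm_of_nonneg hc0]
  exact (mul_le_of_le_one_left (norm_nonneg _) (pow_le_one₀ hc0 hc1)).trans (hK j _)

theorem norm_iteratedFDeriv_one_sub_le {b : Rn n → ℂ} (hb : ContDiff ℝ ∞ b) {K : ℕ → ℝ}
    (hK : ∀ j ξ, ‖iteratedFDeriv ℝ j b ξ‖ ≤ K j) (j : ℕ) (ξ : Rn n) :
    ‖iteratedFDeriv ℝ j (fun ξ => 1 - b ξ) ξ‖ ≤ 1 + K j := by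
  have h1 : (fun ξ => 1 - b ξ) = (fun _ => (1 : ℂ)) - b := rfl
  rw [h1, iteratedFDeriv_sub_apply contDiffAt_const
    (hb.of_le (by exact_mod_cast le_top)).contDiffAt]
  refine (norm_sub_le _ _).trans (add_le_add ?_ (hK j ξ))
  rcases Nat.eq_zero_or_pos j with rfl | hj
  · simp [norm_iteratedFDeriv_zero]
  · rw [iteratedFDeriv_const_of_ne hj.ne']
    simp

/-! ### Low frequencies recover a locally integrable function -/

theorem quasiMeasurePreserving_smul_rn {c : ℝ} (hc : c ≠ 0) :
    Measure.QuasiMeasurePreserving (fun x : Rn n => c • x) volume volume := by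
  refine ⟨measurable_const_smul c, ?_⟩
  rw [Measure.map_addHaar_smul _ hc]
  exact Measure.smul_absolutelyContinuous

theorem lintegral_comp_smul_rn {c : ℝ} (hc : 0 < c) (f : Rn n → ℝ≥0∞) :
    ∫⁻ x, f (c • x) = ENNReal.ofReal (c ^ n)⁻¹ * ∫⁻ x, f x := by
  have h := (Homeomorph.smulOfNeZero c hc.ne' (α := Rn n)).measurableEmbedding.lintegral_map
    (μ := volume) f
  change ∫⁻ x, f x ∂(Measure.map (fun x => c • x) volume) = _ at h
  rw [Measure.map_addHaar_smul _ hc.ne', lintegral_smul_measure, finrank_euclideanSpace_fin,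
    abs_of_pos (by positivity)] at h
  exact h.symm

/-- The part of a contracted kernel away from the origin tends to zero. -/
theorem tendsto_tail_dil (b K : 𝓢(Rn n, ℂ)) {r : ℝ} (hr : 0 < r) (hb : ∀ ξ, ‖ξ‖ < r → b ξ = 1) :
    Tendsto
      (fun N : ℕ => ((N : ℂ) + 1) ^ n • smulLeftCLM ℂ (fun ξ => 1 - b ξ) (dil ((N : ℝ) + 1) K))
      atTop (𝓝 0) := by
  refine tendsto_zero_of_seminorm fun k l => ?_
  have hKb : ∀ j ξ, ‖iteratedFDeriv ℝ j b ξ‖ ≤ SchwartzMap.seminorm ℂ 0 j b := fun j ξ =>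
    b.norm_iteratedFDeriv_le_seminorm ℂ j ξ
  -- In the exponent, `n` compensates the factor `(N+1)^n`, `l` the derivatives of the dilated
  -- kernel, and 1 is left for the decay.
  obtain ⟨C, hC0, hC⟩ := exists_continuous_seminorm_smulLeftCLM_le_of_vanish
    (SchwartzMap.seminorm ℂ k l) (continuous_seminorm k l) K (n + l + 1)
    (fun j => 1 + SchwartzMap.seminorm ℂ 0 j b)
  have hbound : ∀ N : ℕ, SchwartzMap.seminorm ℂ k l
      (((N : ℂ) + 1) ^ n • smulLeftCLM ℂ (fun ξ => 1 - b ξ) (dil ((N : ℝ) + 1) K)) ≤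
      C * r⁻¹ ^ (n + l + 1) * (1 / ((N : ℝ) + 1)) := by
    intro N
    have ht : (0 : ℝ) < (N : ℝ) + 1 := by positivity
    have ht1 : 1 ≤ (N : ℝ) + 1 := by linarith [N.cast_nonneg (α := ℝ)]
    set t : ℝ := (N : ℝ) + 1 with htd
    have hb1 : (fun ξ => 1 - b ξ).HasTemperateGrowth :=
      hasTemperateGrowth_of_bounded (contDiff_const.sub (b.smooth ⊤))
        (norm_iteratedFDeriv_one_sub_le (b.smooth ⊤) hKb)
    have hbs : ContDiff ℝ ∞ (fun ξ => b (t⁻¹ • ξ)) := (b.smooth ⊤).comp (contDiff_const_smul _)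
    have hKt := norm_iteratedFDeriv_one_sub_le hbs
      (norm_iteratedFDeriv_comp_smul_le (b.smooth ⊤) hKb (inv_nonneg.mpr ht.le)
        (inv_le_one_of_one_le₀ ht1))
    have hbt : (fun ξ => 1 - b (t⁻¹ • ξ)).HasTemperateGrowth :=
      hasTemperateGrowth_of_bounded (contDiff_const.sub hbs) hKt
    have heq : smulLeftCLM ℂ (fun ξ => 1 - b ξ) (dil t K) =
        dil t (smulLeftCLM ℂ (fun ξ => 1 - b (t⁻¹ • ξ)) K) := by
      ext ξ
      rw [smulLeftCLM_apply_apply hb1, dil_apply ht.ne', dil_apply ht.ne',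
        smulLeftCLM_apply_apply hbt, inv_smul_smul₀ ht.ne']
    have h1 := hC _ hbt (t * r) (by positivity) hKt fun ξ hξ => by
      rw [hb, sub_self]
      rw [norm_smul, norm_inv, Real.norm_of_nonneg ht.le, inv_mul_lt_iff₀ ht]
      exact hξ
    rw [map_smul_eq_mul, heq, norm_pow]
    have h2 : ‖(N : ℂ) + 1‖ = t := by
      rw [← Complex.ofReal_natCast, ← Complex.ofReal_one, ← Complex.ofReal_add, Complex.norm_real,
        Real.norm_of_nonneg ht.le]
    rw [h2]
    calc _ ≤ t ^ n * (t ^ l * (C * (t * r)⁻¹ ^ (n + l + 1))) := by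
          gcongr
          exact (seminorm_dil_le ht1 k l _).trans (by gcongr)
      _ = C * r⁻¹ ^ (n + l + 1) * (1 / t) := by
          have h3 : t⁻¹ ^ (n + l + 1) = (t ^ n * t ^ l * t)⁻¹ := by
            rw [inv_pow, pow_succ, pow_add]
          rw [mul_inv, mul_pow, h3]
          field_simp
  refine squeeze_zero (fun N => apply_nonneg _ _) hbound ?_
  simpa using (tendsto_one_div_add_atTop_nhds_zero_nat (𝕜 := ℝ)).const_mul (C * r⁻¹ ^ (n + l + 1))

theorem integral_fourier_eq_apply_zero (m : 𝓢(Rn n, ℂ)) : ∫ x, 𝓕 m x = m 0 := by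
  have h : 𝓕⁻ (𝓕 m) 0 = m 0 := by rw [FourierTransform.fourierInv_fourier_eq]
  rw [← h, fourierInv_coe, Real.fourierInv_eq]
  simp

/-- Testing a distribution against contracted kernels gives the values of the function that
represents it, at points of continuity. -/
theorem tendsto_apply_compSubConst_dil {g : Rn n → ℂ} {v : 𝓢'(Rn n, ℂ)} (hv : Represents g v)
    {U : Set (Rn n)} (hU : IsOpen U) (hg : ContinuousOn g U) {x : Rn n} (hx : x ∈ U)
    (m : 𝓢(Rn n, ℂ)) :
    Tendsto (fun N : ℕ => ((N : ℂ) + 1) ^ n * v (compSubConstCLM ℂ x (dil ((N : ℝ) + 1) (𝓕 m))))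
      atTop (𝓝 (g x * m 0)) := by
  obtain ⟨ε, hε, hεU⟩ := Metric.isOpen_iff.mp hU x hx
  have hr : 0 < ε / 3 := by positivity
  let β := bumpAt (0 : Rn n) (ε / 3) hr
  let b : 𝓢(Rn n, ℂ) := bumpSchwartz β 1
  have hb1 : ∀ ξ, ‖ξ‖ < ε / 3 → b ξ = 1 := by
    intro ξ hξ
    have : β ξ = 1 := ContDiffBump.one_of_mem_closedBall _ (by simpa [β, bumpAt] using hξ.le)
    simp [b, bumpSchwartz_apply, this]
  have hcb : (fun ξ => 1 - b ξ).HasTemperateGrowth :=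
    (Function.HasTemperateGrowth.const (1 : ℂ)).sub b.hasTemperateGrowth
  set K := 𝓕 m with hK
  -- Nothing is known of `g` far from `x`, so only this localized, bounded and continuous part is
  -- integrated against the kernel, by dominated convergence. The remainder is handled by continuity
  -- of `v` on the Schwartz space.
  let G : Rn n → ℂ := fun y => b (y - x) * g y
  have hcsub : HasCompactSupport (fun y => b (y - x)) :=
    (hasCompactSupport_bumpSchwartz β 1).comp_homeomorph (Homeomorph.subRight x)
  have hGcs : HasCompactSupport G := hcsub.mul_right
  have htsupp : tsupport G ⊆ U := by
    have h1 : Function.support G ⊆ Metric.closedBall x (2 * (ε / 3)) := by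
      intro y hy
      have h2 : β (y - x) ≠ 0 := by
        intro h0
        exact hy (by simp [G, b, bumpSchwartz_apply, h0])
      by_contra h3
      refine h2 (ContDiffBump.zero_of_le_dist _ ?_)
      simp only [Metric.mem_closedBall, not_le, dist_eq_norm] at h3
      simpa [β, bumpAt] using h3.le
    refine (closure_minimal h1 Metric.isClosed_closedBall).trans (subset_trans ?_ hεU)
    exact Metric.closedBall_subset_ball (by linarith)
  have hGc : Continuous G := by
    refine ContinuousOn.continuous_of_tsupport_subset (s := U) ?_ hU htsupp
    exact ((b.continuous.comp (continuous_id.sub continuous_const)).continuousOn).mul hg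
  obtain ⟨B, hB⟩ := hGcs.exists_bound_of_continuous hGc
  have hmain : ∀ N : ℕ, ((N : ℂ) + 1) ^ n * v (compSubConstCLM ℂ x (dil ((N : ℝ) + 1) K)) =
      (∫ z, G (x + ((N : ℝ) + 1)⁻¹ • z) * K z) + v (compSubConstCLM ℂ x (((N : ℂ) + 1) ^ n •
        smulLeftCLM ℂ (fun ξ => 1 - b ξ) (dil ((N : ℝ) + 1) K))) := by
    intro N
    have ht : (0 : ℝ) < (N : ℝ) + 1 := by positivity
    have hsplit : dil ((N : ℝ) + 1) K = smulLeftCLM ℂ (fun ξ => b ξ) (dil ((N : ℝ) + 1) K) +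
        smulLeftCLM ℂ (fun ξ => 1 - b ξ) (dil ((N : ℝ) + 1) K) := by
      ext ξ
      rw [add_apply, smulLeftCLM_apply_apply b.hasTemperateGrowth, smulLeftCLM_apply_apply hcb,
        ← add_smul, add_sub_cancel, one_smul]
    have hpow : ((N : ℂ) + 1) ^ n ≠ 0 := pow_ne_zero _ (by exact_mod_cast ht.ne')
    rw [map_smul, map_smul, smul_eq_mul]
    conv_lhs => rw [hsplit, map_add, map_add, mul_add]
    congr 1
    rw [hv.2]
    · have h1 : ∀ z, G (x + ((N : ℝ) + 1)⁻¹ • z) * K z =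
          (fun y => G (x + y) * K (((N : ℝ) + 1) • y)) (((N : ℝ) + 1)⁻¹ • z) := fun z => by
        simp only [smul_inv_smul₀ ht.ne']
      simp_rw [h1]
      rw [integral_comp_smul_rn (inv_pos.mpr ht) (fun y => G (x + y) * K (((N : ℝ) + 1) • y)),
        ← integral_add_left_eq_self _ x]
      congr 1
      · push_cast; rw [inv_pow, inv_inv]
      · congr 1 with y
        rw [compSubConstCLM_apply, smulLeftCLM_apply_apply b.hasTemperateGrowth, dil_apply ht.ne']
        simp only [G, add_sub_cancel_left, smul_eq_mul]
        ring
    · have h1 : ⇑(compSubConstCLM ℂ x (smulLeftCLM ℂ (fun ξ => b ξ) (dil ((N : ℝ) + 1) K))) =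
          fun y => b (y - x) * dil ((N : ℝ) + 1) K (y - x) := by
        funext y
        rw [compSubConstCLM_apply, smulLeftCLM_apply_apply b.hasTemperateGrowth, smul_eq_mul]
      rw [h1]
      exact hcsub.mul_right
  simp_rw [hmain]
  have hpart1 : Tendsto (fun N : ℕ => ∫ z, G (x + ((N : ℝ) + 1)⁻¹ • z) * K z) atTop
      (𝓝 (∫ z, G x * K z)) := by
    refine tendsto_integral_of_dominated_convergence (fun z => B * ‖K z‖) (fun N => ?_)
      (K.integrable.norm.const_mul B) (fun N => Eventually.of_forall fun z => ?_)
      (Eventually.of_forall fun z => ?_)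
    · exact ((hGc.comp (by fun_prop)).mul K.continuous).aestronglyMeasurable
    · rw [norm_mul]; gcongr; exact hB _
    · refine Tendsto.mul_const _ ?_
      have h1 : Tendsto (fun N : ℕ => x + ((N : ℝ) + 1)⁻¹ • z) atTop (𝓝 x) := by
        have := ((tendsto_one_div_add_atTop_nhds_zero_nat (𝕜 := ℝ)).smul_const z).const_add x
        simpa using this
      exact (hGc.tendsto x).comp h1
  have hpart2 := tendsto_tail_dil b K hr hb1
  have hvc : Continuous fun ψ : 𝓢(Rn n, ℂ) => v (compSubConstCLM ℂ x ψ) :=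
    (map_continuous v).comp (compSubConstCLM ℂ x).continuous
  have hpart3 := (hvc.tendsto 0).comp hpart2
  have h0 : b 0 = 1 := hb1 0 (by simpa using hr)
  have := hpart1.add hpart3
  simp only [map_zero, add_zero, integral_const_mul, hK, integral_fourier_eq_apply_zero] at this
  simpa [G, h0] using! this

/-- A lower semicontinuity property: the `L^r` norm of a function, continuous off the origin, is
controlled by the low frequency parts of its dilations. -/
theorem lintegral_le_liminf_of_represents (hn : 0 < n) {g : Rn n → ℂ} (hg : ContinuousOn g {0}ᶜ)
    (m : 𝓢(Rn n, ℂ)) (hm : m 0 = 1) {r : ℝ} (w : ℕ → 𝓢'(Rn n, ℂ))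
    (hw : ∀ N : ℕ, Represents (fun x => g (((N : ℝ) + 1)⁻¹ • x)) (w N)) (F : ℕ → Rn n → ℂ)
    (hF : ∀ N, Represents (F N)
      (TemperedDistribution.fourierMultiplierCLM ℂ (fun ξ => m ξ) (w N))) :
    ∫⁻ x, ‖g x‖ₑ ^ r ≤
      liminf (fun N : ℕ => ENNReal.ofReal (((N : ℝ) + 1) ^ n)⁻¹ * ∫⁻ x, ‖F N x‖ₑ ^ r) atTop := by
  have ht : ∀ N : ℕ, (0 : ℝ) < (N : ℝ) + 1 := fun N => by positivity
  -- At index 0 the dilation factor is 1, so `w 0` is the distribution of `g` itself.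
  have hv : Represents g (w 0) := by simpa using hw 0
  have hval : ∀ᵐ x : Rn n, ∀ N : ℕ, F N (((N : ℝ) + 1) • x) =
      ((N : ℂ) + 1) ^ n * w 0 (compSubConstCLM ℂ x (dil ((N : ℝ) + 1) (𝓕 m))) := by
    rw [ae_all_iff]
    intro N
    filter_upwards [(quasiMeasurePreserving_smul_rn (ht N).ne').ae
      (ae_eq_of_represents_fourierMultiplier m (w N) (hF N))] with x hx
    rw [hx, hv.apply_of_comp_smul (ht N) (hw N)]
    push_cast
    congr 2
    ext y
    rw [dil_apply (ht N).ne', compSubConstCLM_apply, compSubConstCLM_apply, dil_apply (ht N).ne',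
      smul_sub]
  have : Nonempty (Fin n) := ⟨⟨0, hn⟩⟩
  have hne : ∀ᵐ x : Rn n, x ≠ 0 := by
    simp [ae_iff]
  -- The rescaled values of `F N` are tests of `w 0` against contracting kernels, so they tend to `g
  -- x` off the origin, a null set; Fatou's lemma follows.
  calc ∫⁻ x, ‖g x‖ₑ ^ r
      = ∫⁻ x, liminf (fun N : ℕ => ‖F N (((N : ℝ) + 1) • x)‖ₑ ^ r) atTop := by
        refine lintegral_congr_ae ?_
        filter_upwards [hval, hne] with x hx hx0
        have h1 := tendsto_apply_compSubConst_dil hv isOpen_compl_singleton hg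
          (show x ∈ ({0}ᶜ : Set (Rn n)) from hx0) m
        rw [hm, mul_one] at h1
        have h2 : Tendsto (fun N : ℕ => ‖F N (((N : ℝ) + 1) • x)‖ₑ ^ r) atTop (𝓝 (‖g x‖ₑ ^ r)) := by
          simp_rw [hx]
          exact (ENNReal.continuous_rpow_const.tendsto _).comp
            ((continuous_enorm.tendsto _).comp h1)
        exact h2.liminf_eq.symm
    _ ≤ liminf (fun N : ℕ => ∫⁻ x, ‖F N (((N : ℝ) + 1) • x)‖ₑ ^ r) atTop := by
        refine lintegral_liminf_le' fun N => ?_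
        exact (((hF N).1.aestronglyMeasurable.comp_quasiMeasurePreserving
          (quasiMeasurePreserving_smul_rn (ht N).ne')).enorm).pow_const r
    _ = _ := by
        congr 1 with N
        exact lintegral_comp_smul_rn (ht N) (fun x => ‖F N x‖ₑ ^ r)

/-! ### Decay of frequency pieces of Schwartz functions -/

theorem one_add_pow_le (a : ℝ) (ha : 0 ≤ a) (M : ℕ) : (1 + a) ^ M ≤ 2 ^ M * (1 + a ^ M) := by
  refine (add_pow_le zero_le_one ha M).trans ?_
  rw [one_pow]
  gcongr
  · norm_num
  · exact Nat.sub_le M 1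

/-- A Fourier multiplier that vanishes for `‖ξ‖ < ρ` maps a fixed Schwartz function to a rapidly
decaying function of size `O(ρ⁻ᴾ)`. -/
theorem exists_norm_fourierMultiplierCLM_le (f : 𝓢(Rn n, ℂ)) (M P : ℕ) (K : ℕ → ℝ) :
    ∃ C : ℝ, 0 ≤ C ∧ ∀ μ : Rn n → ℂ, ContDiff ℝ ∞ μ → ∀ ρ : ℝ, 0 < ρ →
      (∀ j ξ, ‖iteratedFDeriv ℝ j μ ξ‖ ≤ K j) → (∀ ξ, ‖ξ‖ < ρ → μ ξ = 0) → ∀ x,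
      ‖SchwartzMap.fourierMultiplierCLM ℂ μ f x‖ ≤ C * ρ⁻¹ ^ P * (1 + ‖x‖) ^ (-M : ℝ) := by
  let L : 𝓢(Rn n, ℂ) →L[ℂ] 𝓢(Rn n, ℂ) := FourierTransform.fourierInvCLM ℂ 𝓢(Rn n, ℂ)
  let Q₀ : Seminorm ℂ 𝓢(Rn n, ℂ) := SchwartzMap.seminorm ℂ 0 0 + SchwartzMap.seminorm ℂ M 0
  have hQ₀ : Continuous Q₀ := (continuous_seminorm 0 0).add (continuous_seminorm M 0)
  let Q : Seminorm ℂ 𝓢(Rn n, ℂ) := Q₀.comp L.toLinearMap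
  have hQ : Continuous Q := hQ₀.comp L.continuous
  obtain ⟨C, hC0, hC⟩ := exists_continuous_seminorm_smulLeftCLM_le_of_vanish Q hQ (𝓕 f) P K
  refine ⟨2 ^ M * C, by positivity, fun μ hμ ρ hρ hK hv x => ?_⟩
  have h1 := hC μ (hasTemperateGrowth_of_bounded hμ hK) ρ hρ hK hv
  set h := SchwartzMap.fourierMultiplierCLM ℂ μ f with hh
  have h2 : Q (smulLeftCLM ℂ μ (𝓕 f)) =
    SchwartzMap.seminorm ℂ 0 0 h + SchwartzMap.seminorm ℂ M 0 h := rfl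
  have h3 := h.norm_le_seminorm ℂ x
  have h4 := h.norm_pow_mul_le_seminorm ℂ M x
  have hx : 0 < 1 + ‖x‖ := by positivity
  rw [Real.rpow_neg hx.le, Real.rpow_natCast, ← div_eq_mul_inv, le_div_iff₀ (by positivity)]
  calc ‖h x‖ * (1 + ‖x‖) ^ M ≤ ‖h x‖ * (2 ^ M * (1 + ‖x‖ ^ M)) := by
        gcongr; exact one_add_pow_le _ (norm_nonneg x) M
    _ = 2 ^ M * (‖h x‖ + ‖x‖ ^ M * ‖h x‖) := by ring
    _ ≤ 2 ^ M * (C * ρ⁻¹ ^ P) := by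
        gcongr
        linarith
    _ = _ := by ring

/-- A family of smooth symbols such that `m i₀ = 1` near the origin and the other symbols
live at frequencies `‖ξ‖ ≥ ρ i`. -/
structure IsSymbolFamily {ι : Type} (i₀ : ι) (m : ι → Rn n → ℂ) (ρ : ι → ℝ) : Prop where
  smooth : ∀ i, ContDiff ℝ ∞ (m i)
  compact : ∀ i, HasCompactSupport (m i)
  bound : ∃ K : ℕ → ℝ, ∀ i j ξ, ‖iteratedFDeriv ℝ j (m i) ξ‖ ≤ K j
  pos : ∀ i, 0 < ρ i
  le_one : ρ i₀ ≤ 1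
  vanish : ∀ i, i ≠ i₀ → ∀ ξ, ‖ξ‖ < ρ i → m i ξ = 0
  eq_one : ∀ ξ, ‖ξ‖ < ρ i₀ → m i₀ ξ = 1

theorem IsSymbolFamily.hasTemperateGrowth {ι : Type} {i₀ : ι} {m : ι → Rn n → ℂ} {ρ : ι → ℝ}
    (hm : IsSymbolFamily i₀ m ρ) (i : ι) : (m i).HasTemperateGrowth :=
  ((hm.compact i).toSchwartzMap (hm.smooth i)).hasTemperateGrowth

/-- The function that dominates the frequency pieces of `f(t⁻¹ ·)`. -/
def envelope (f : Rn n → ℂ) (M : ℕ) (e t : ℝ) (x : Rn n) : ℝ :=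
  ‖f (t⁻¹ • x)‖ + e * t⁻¹ * (1 + ‖t⁻¹ • x‖) ^ (-M : ℝ)

theorem represents_schwartz (f : 𝓢(Rn n, ℂ)) : Represents f (f : 𝓢'(Rn n, ℂ)) :=
  ⟨f.continuous.locallyIntegrable, fun g _ => SchwartzMap.coe_apply f g⟩

/-- The piece of index `i` of `f(·/t)` is the dilate of the multiplier with symbol `m i (·/t)`
applied to `f`. For `i ≠ i₀` this symbol vanishes on the ball of radius `t ρ i`, which gives `(t ρ
i)⁻ᴾ`. For `i₀` the same estimate applies to `1 - m i₀ (·/t)`, so that piece is `f` up to a small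
error. The constant `e` depends on `f` but not on `t` or `i`. -/
theorem IsSymbolFamily.exists_pieces_le {ι : Type} {i₀ : ι} {m : ι → Rn n → ℂ} {ρ : ι → ℝ}
    (hm : IsSymbolFamily i₀ m ρ) (f : 𝓢(Rn n, ℂ)) (M : ℕ) {P : ℕ} (hP : 1 ≤ P) :
    ∃ e : ℝ, 0 ≤ e ∧ ∀ t : ℝ, 1 ≤ t → ∃ g : ι → 𝓢(Rn n, ℂ),
      (∀ i, TemperedDistribution.fourierMultiplierCLM ℂ (m i) (dil t⁻¹ f : 𝓢'(Rn n, ℂ)) = g i) ∧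
      ∀ i x, ‖g i x‖ ≤ (ρ i)⁻¹ ^ P * envelope f M e t x := by
  obtain ⟨K, hK⟩ := hm.bound
  obtain ⟨C₁, hC₁0, hC₁⟩ := exists_norm_fourierMultiplierCLM_le f M P K
  obtain ⟨C₂, hC₂0, hC₂⟩ := exists_norm_fourierMultiplierCLM_le f M P (fun j => 1 + K j)
  refine ⟨C₁ + C₂ * (ρ i₀)⁻¹ ^ P, by have := hm.pos i₀; positivity, fun t ht => ?_⟩
  have ht0 : 0 < t := by linarith
  have htP : t⁻¹ ^ P ≤ t⁻¹ :=
    pow_le_of_le_one (inv_nonneg.mpr ht0.le) (inv_le_one_of_one_le₀ ht) (by omega)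
  refine ⟨fun i => SchwartzMap.fourierMultiplierCLM ℂ (m i) (dil t⁻¹ f), fun i =>
    TemperedDistribution.fourierMultiplierCLM_toTemperedDistributionCLM_eq
      (hm.hasTemperateGrowth i) _, fun i x => ?_⟩
  beta_reduce
  rw [fourierMultiplierCLM_dil (inv_pos.mpr ht0) (hm.hasTemperateGrowth i),
    dil_apply (inv_ne_zero ht0.ne')]
  set y := t⁻¹ • x with hy
  have hρ := hm.pos i
  have hρ₀ := hm.pos i₀
  have hnorm : ∀ ξ : Rn n, ∀ r, ‖ξ‖ < t * r → ‖t⁻¹ • ξ‖ < r := fun ξ r h => by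
    rw [norm_smul, norm_inv, Real.norm_of_nonneg ht0.le, inv_mul_lt_iff₀ ht0]
    exact h
  have hsm : ContDiff ℝ ∞ (fun ξ => m i (t⁻¹ • ξ)) := (hm.smooth i).comp (contDiff_const_smul _)
  have hbd : ∀ j ξ, ‖iteratedFDeriv ℝ j (fun ξ => m i (t⁻¹ • ξ)) ξ‖ ≤ K j :=
    norm_iteratedFDeriv_comp_smul_le (hm.smooth i) (hK i) (inv_nonneg.mpr ht0.le)
        (inv_le_one_of_one_le₀ ht)
  have hw : 0 ≤ (1 + ‖y‖) ^ (-M : ℝ) := by positivity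
  simp only [envelope, ← hy]
  by_cases hi : i = i₀
  · subst hi
    have hbd' := norm_iteratedFDeriv_one_sub_le hsm hbd
    have h1 := hC₂ _ (contDiff_const.sub hsm) (t * ρ i) (by positivity) hbd' (fun ξ hξ => by
      rw [hm.eq_one _ (hnorm ξ _ hξ), sub_self]) y
    have htg := hasTemperateGrowth_comp_smul (hm.hasTemperateGrowth i) t⁻¹
    have h2 : SchwartzMap.fourierMultiplierCLM ℂ (fun ξ => m i (t⁻¹ • ξ)) f =
        f - SchwartzMap.fourierMultiplierCLM ℂ (fun ξ => 1 - m i (t⁻¹ • ξ)) f := by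
      rw [SchwartzMap.fourierMultiplierCLM_apply, SchwartzMap.fourierMultiplierCLM_apply]
      have h3 : smulLeftCLM ℂ (fun ξ => 1 - m i (t⁻¹ • ξ)) (𝓕 f) =
          𝓕 f - smulLeftCLM ℂ (fun ξ => m i (t⁻¹ • ξ)) (𝓕 f) := by
        ext ξ
        rw [sub_apply, smulLeftCLM_apply_apply htg, smulLeftCLM_apply_apply
          (hasTemperateGrowth_of_bounded (contDiff_const.sub hsm) hbd'), sub_smul, one_smul]
      have h5 : ∀ a b : 𝓢(Rn n, ℂ), 𝓕⁻ (a - b) = 𝓕⁻ a - 𝓕⁻ b :=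
        map_sub (FourierTransform.fourierInvCLM ℂ 𝓢(Rn n, ℂ))
      rw [h3, h5, FourierTransform.fourierInv_fourier_eq, sub_sub_cancel]
    rw [h2, sub_apply]
    refine (norm_sub_le _ _).trans ?_
    -- Since `ρ i₀ ≤ 1`, the low-frequency piece can carry the same prefactor as the others.
    have h4 : 1 ≤ (ρ i)⁻¹ ^ P := one_le_pow₀ ((one_le_inv₀ hρ).mpr hm.le_one)
    refine le_trans ?_ (le_mul_of_one_le_left (by positivity) h4)
    gcongr
    refine h1.trans (mul_le_mul_of_nonneg_right ?_ hw)
    calc C₂ * (t * ρ i)⁻¹ ^ P = C₂ * (ρ i)⁻¹ ^ P * t⁻¹ ^ P := by rw [mul_inv, mul_pow]; ring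
      _ ≤ C₂ * (ρ i)⁻¹ ^ P * t⁻¹ := by gcongr
      _ ≤ _ := by gcongr; exact le_add_of_nonneg_left hC₁0
  · have h1 := hC₁ _ hsm (t * ρ i) (by positivity) hbd
      (fun ξ hξ => hm.vanish i hi _ (hnorm ξ _ hξ)) y
    refine h1.trans ?_
    calc C₁ * (t * ρ i)⁻¹ ^ P * (1 + ‖y‖) ^ (-M : ℝ)
        = (ρ i)⁻¹ ^ P * (C₁ * t⁻¹ ^ P * (1 + ‖y‖) ^ (-M : ℝ)) := by rw [mul_inv, mul_pow]; ring
      _ ≤ (ρ i)⁻¹ ^ P * ((C₁ + C₂ * (ρ i₀)⁻¹ ^ P) * t⁻¹ * (1 + ‖y‖) ^ (-M : ℝ)) := by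
          have : 0 ≤ C₂ * (ρ i₀)⁻¹ ^ P := by positivity
          gcongr
          linarith
      _ ≤ _ := by
          gcongr
          linarith [norm_nonneg (f y)]

/-! ### The quasi-norms -/

theorem lqNorm_mono {ι : Type} (q : ℝ≥0∞) {a b : ι → ℝ≥0∞} (h : ∀ i, a i ≤ b i) :
    lqNorm q a ≤ lqNorm q b := by
  unfold lqNorm
  split_ifs
  · exact iSup_mono h
  · gcongr with i
    exact h i

theorem lqNorm_mul_const {ι : Type} {q : ℝ≥0∞} (hq : 0 < q) (a : ι → ℝ≥0∞) (c : ℝ≥0∞) :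
    lqNorm q (fun i => a i * c) = lqNorm q a * c := by
  unfold lqNorm
  split_ifs with h
  · rw [ENNReal.iSup_mul]
  · have hq0 : 0 < q.toReal := ENNReal.toReal_pos hq.ne' h
    simp_rw [ENNReal.mul_rpow_of_nonneg _ _ hq0.le]
    rw [ENNReal.tsum_mul_right, ENNReal.mul_rpow_of_nonneg _ _ (by positivity), one_div,
      ENNReal.rpow_rpow_inv hq0.ne']

theorem le_lqNorm {ι : Type} {q : ℝ≥0∞} (hq : 0 < q) (a : ι → ℝ≥0∞) (i : ι) :
    a i ≤ lqNorm q a := by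
  unfold lqNorm
  split_ifs with h
  · exact le_iSup a i
  · have hq0 : 0 < q.toReal := ENNReal.toReal_pos hq.ne' h
    calc a i = (a i ^ q.toReal) ^ (1 / q.toReal) := by rw [one_div, ENNReal.rpow_rpow_inv hq0.ne']
      _ ≤ _ := by
        gcongr
        exact ENNReal.le_tsum i

theorem lqNorm_zero {ι : Type} {q : ℝ≥0∞} (hq : 0 < q) : lqNorm q (fun _ : ι => 0) = 0 := by
  simpa using lqNorm_mul_const hq (fun _ : ι => 0) 0

theorem represents_zero : Represents (fun _ : Rn n => 0) (0 : 𝓢'(Rn n, ℂ)) :=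
  ⟨locallyIntegrable_const 0, fun g _ => by simp⟩

theorem distLpNorm_le {p : ℝ≥0∞} {u : 𝓢'(Rn n, ℂ)} {f : Rn n → ℂ} (h : Represents f u) :
    distLpNorm p u ≤ eLpNorm f p volume :=
  iInf₂_le f h

/-- The properties shared by the quasi-norms of Besov, Triebel-Lizorkin and modulation spaces: they
dominate the `L^p` norm of the low frequencies, and on dilated Schwartz functions they are dominated
by an `L^p` norm in the limit. -/
structure IsAdmissibleNorm (p : ℝ≥0∞) (N : 𝓢'(Rn n, ℂ) → ℝ≥0∞) : Prop where
  map_zero : N 0 = 0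
  lower : ∃ m : 𝓢(Rn n, ℂ), m 0 = 1 ∧ ∀ v,
    distLpNorm p (TemperedDistribution.fourierMultiplierCLM ℂ (fun ξ => m ξ) v) ≤ N v
  upper : ∀ M : ℕ, ∃ D : ℝ≥0, ∀ f : 𝓢(Rn n, ℂ), ∃ e : ℝ, 0 ≤ e ∧ ∀ t : ℝ, 1 ≤ t →
    N (dil t⁻¹ f : 𝓢'(Rn n, ℂ)) ≤ D * eLpNorm (envelope f M e t) p volume

variable {ι : Type} {i₀ : ι} {m : ι → Rn n → ℂ} {ρ : ι → ℝ} {w : ι → ℝ≥0∞} {p q : ℝ≥0∞}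

theorem envelope_nonneg (f : Rn n → ℂ) (M : ℕ) {e t : ℝ} (he : 0 ≤ e) (ht : 1 ≤ t) (x : Rn n) :
    0 ≤ envelope f M e t x := by
  unfold envelope
  have : 0 < t := by linarith
  positivity

theorem IsSymbolFamily.exists_lower (hm : IsSymbolFamily i₀ m ρ) :
    ∃ m₀ : 𝓢(Rn n, ℂ), m₀ 0 = 1 ∧ (fun ξ => m₀ ξ) = m i₀ :=
  ⟨(hm.compact i₀).toSchwartzMap (hm.smooth i₀),
    hm.eq_one 0 (by simpa using hm.pos i₀), rfl⟩

theorem enorm_le_of_norm_le_mul {a : ℂ} {b c : ℝ} (hb : 0 ≤ b) (hc : 0 ≤ c)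
    (h : ‖a‖ ≤ b * c) : ‖a‖ₑ ≤ ENNReal.ofReal b * ‖c‖ₑ := by
  rw [← ofReal_norm, ← ofReal_norm, ← ENNReal.ofReal_mul hb,
    Real.norm_of_nonneg hc]
  exact ENNReal.ofReal_le_ofReal h

/-- The lower bound is the term `i₀`, of weight 1. For the upper bound, the envelope does not depend
on `i` and leaves the `ℓ^q` norm; the finite quantity that remains is a constant independent of `f`.
-/
theorem IsSymbolFamily.isAdmissibleNorm_lqLp (hm : IsSymbolFamily i₀ m ρ) (hq : 0 < q)
    (hw : w i₀ = 1) {P : ℕ} (hP : 1 ≤ P)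
    (hfin : lqNorm q (fun i => w i * ENNReal.ofReal ((ρ i)⁻¹ ^ P)) ≠ ⊤) :
    IsAdmissibleNorm p (fun u : 𝓢'(Rn n, ℂ) => lqNorm q fun i =>
      w i * distLpNorm p (TemperedDistribution.fourierMultiplierCLM ℂ (m i) u)) where
  map_zero := by
    have h1 : distLpNorm p (0 : 𝓢'(Rn n, ℂ)) = 0 := by
      simpa using distLpNorm_le (p := p) (represents_zero (n := n))
    simpa [h1] using lqNorm_zero hq
  lower := by
    obtain ⟨m₀, h0, h1⟩ := hm.exists_lower
    refine ⟨m₀, h0, fun v => ?_⟩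
    rw [h1]
    simpa [hw] using le_lqNorm hq (fun i =>
      w i * distLpNorm p (TemperedDistribution.fourierMultiplierCLM ℂ (m i) v)) i₀
  upper M := by
    refine ⟨(lqNorm q (fun i => w i * ENNReal.ofReal ((ρ i)⁻¹ ^ P))).toNNReal, fun f => ?_⟩
    obtain ⟨e, he, h⟩ := hm.exists_pieces_le f M hP
    refine ⟨e, he, fun t ht => ?_⟩
    obtain ⟨g, hg1, hg2⟩ := h t ht
    rw [ENNReal.coe_toNNReal hfin, ← lqNorm_mul_const hq]
    refine lqNorm_mono q fun i => ?_
    rw [hg1, mul_assoc]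
    gcongr
    refine (distLpNorm_le (represents_schwartz (g i))).trans ?_
    have hρ := hm.pos i
    refine eLpNorm_le_mul_eLpNorm_of_ae_le_mul' (c := ((ρ i)⁻¹ ^ P).toNNReal)
      (Eventually.of_forall fun x => ?_) p
    exact enorm_le_of_norm_le_mul (by positivity) (envelope_nonneg f M he ht x) (hg2 i x)

/-- Same argument, with the envelope factored out pointwise before the `L^p` norm is taken. -/
theorem IsSymbolFamily.isAdmissibleNorm_Lplq (hm : IsSymbolFamily i₀ m ρ) (hq : 0 < q)
    (hw : w i₀ = 1) {P : ℕ} (hP : 1 ≤ P)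
    (hfin : lqNorm q (fun i => w i * ENNReal.ofReal ((ρ i)⁻¹ ^ P)) ≠ ⊤) :
    IsAdmissibleNorm p (fun u : 𝓢'(Rn n, ℂ) => ⨅ (g : ι → Rn n → ℂ)
      (_ : ∀ i, Represents (g i) (TemperedDistribution.fourierMultiplierCLM ℂ (m i) u)),
      eLpNorm (fun x => lqNorm q fun i => w i * ‖g i x‖ₑ) p volume) where
  map_zero := by
    have h1 : ∀ i, Represents ((fun _ _ => 0 : ι → Rn n → ℂ) i)
        (TemperedDistribution.fourierMultiplierCLM ℂ (m i) (0 : 𝓢'(Rn n, ℂ))) := fun i => by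
      rw [map_zero]; exact represents_zero
    have h2 := iInf₂_le (f := fun (g : ι → Rn n → ℂ) (_ : ∀ i, Represents (g i)
      (TemperedDistribution.fourierMultiplierCLM ℂ (m i) (0 : 𝓢'(Rn n, ℂ)))) =>
      eLpNorm (fun x => lqNorm q fun i => w i * ‖g i x‖ₑ) p volume) _ h1
    refine le_antisymm (h2.trans ?_) zero_le
    simp [lqNorm_zero hq]
  lower := by
    obtain ⟨m₀, h0, h1⟩ := hm.exists_lower
    refine ⟨m₀, h0, fun v => le_iInf₂ fun g hg => ?_⟩
    rw [h1]
    refine (distLpNorm_le (hg i₀)).trans (eLpNorm_mono_enorm fun x => ?_)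
    simpa [hw] using le_lqNorm hq (fun i => w i * ‖g i x‖ₑ) i₀
  upper M := by
    refine ⟨(lqNorm q (fun i => w i * ENNReal.ofReal ((ρ i)⁻¹ ^ P))).toNNReal, fun f => ?_⟩
    obtain ⟨e, he, h⟩ := hm.exists_pieces_le f M hP
    refine ⟨e, he, fun t ht => ?_⟩
    obtain ⟨g, hg1, hg2⟩ := h t ht
    have hrep : ∀ i, Represents ((fun i => ⇑(g i)) i)
        (TemperedDistribution.fourierMultiplierCLM ℂ (m i) (dil t⁻¹ f : 𝓢'(Rn n, ℂ))) := fun i => by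
      rw [hg1]; exact represents_schwartz (g i)
    refine (iInf₂_le (fun i => ⇑(g i)) hrep).trans ?_
    refine eLpNorm_le_mul_eLpNorm_of_ae_le_mul' (Eventually.of_forall fun x => ?_) p
    rw [ENNReal.coe_toNNReal hfin, ← lqNorm_mul_const hq, enorm_eq_self]
    refine lqNorm_mono q fun i => ?_
    rw [mul_assoc]
    gcongr
    have hρ := hm.pos i
    exact enorm_le_of_norm_le_mul (by positivity) (envelope_nonneg f M he ht x) (hg2 i x)

/-! ### From boundedness on a function space to boundedness on `L^p` -/

theorem eLpNorm_rpow_toReal {ε : Type*} [ENorm ε] {p : ℝ≥0∞} (hp₀ : p ≠ 0) (hp₁ : p ≠ ⊤)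
    (f : Rn n → ε) : eLpNorm f p volume ^ p.toReal = ∫⁻ x, ‖f x‖ₑ ^ p.toReal := by
  rw [eLpNorm_eq_lintegral_rpow_enorm_toReal hp₀ hp₁, one_div,
    ENNReal.rpow_inv_rpow (ENNReal.toReal_pos hp₀ hp₁).ne']

/-- The infimum is attained because the pointwise formula for `m(D) v` makes the representing
function unique almost everywhere. -/
theorem exists_represents_eLpNorm_eq {p : ℝ≥0∞} (m : 𝓢(Rn n, ℂ)) {v : 𝓢'(Rn n, ℂ)}
    (h : distLpNorm p (TemperedDistribution.fourierMultiplierCLM ℂ (fun ξ => m ξ) v) < ⊤) :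
    ∃ F : Rn n → ℂ, Represents F (TemperedDistribution.fourierMultiplierCLM ℂ (fun ξ => m ξ) v) ∧
      eLpNorm F p volume =
        distLpNorm p (TemperedDistribution.fourierMultiplierCLM ℂ (fun ξ => m ξ) v) := by
  simp only [distLpNorm, iInf_lt_iff] at h
  obtain ⟨F, hF, -⟩ := h
  refine ⟨F, hF, le_antisymm (le_iInf₂ fun G hG => ?_) (iInf₂_le F hF)⟩
  refine (eLpNorm_congr_ae ?_).le
  filter_upwards [ae_eq_of_represents_fourierMultiplier m v hF,
    ae_eq_of_represents_fourierMultiplier m v hG] with x h1 h2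
  rw [h1, h2]

/-- Rescaling by `t` undoes the dilation, and `(a + b)^r ≤ a^r + b^r` for `r ≤ 1` separates `f` from
the error, which disappears as `t → ∞`. -/
theorem lintegral_envelope_le {r : ℝ} (hr₀ : 0 ≤ r) (hr₁ : r ≤ 1) {f : Rn n → ℂ}
    (hf : Continuous f) (M : ℕ) {e t : ℝ} (he : 0 ≤ e) (ht : 0 < t) :
    ENNReal.ofReal (t ^ n)⁻¹ * ∫⁻ x, ‖envelope f M e t x‖ₑ ^ r ≤
      (∫⁻ x, ‖f x‖ₑ ^ r) +
        ENNReal.ofReal (e * t⁻¹) ^ r * ∫⁻ x : Rn n, ‖(1 + ‖x‖) ^ (-M : ℝ)‖ₑ ^ r := by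
  rw [← lintegral_comp_smul_rn ht (fun x => ‖envelope f M e t x‖ₑ ^ r)]
  have hm : Measurable fun x => ‖f x‖ₑ ^ r := (hf.enorm.measurable).pow_const r
  have hpow : ENNReal.ofReal (e * t⁻¹) ^ r ≠ ⊤ :=
    ENNReal.rpow_ne_top_of_nonneg hr₀ ENNReal.ofReal_ne_top
  rw [← lintegral_const_mul' _ _ hpow, ← lintegral_add_left hm]
  refine lintegral_mono fun x => ?_
  have h1 : envelope f M e t (t • x) = ‖f x‖ + e * t⁻¹ * (1 + ‖x‖) ^ (-M : ℝ) := by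
    rw [envelope, inv_smul_smul₀ ht.ne']
  have h2 : ‖‖f x‖ + e * t⁻¹ * (1 + ‖x‖) ^ (-M : ℝ)‖ₑ ≤
      ‖f x‖ₑ + ENNReal.ofReal (e * t⁻¹) * ‖(1 + ‖x‖) ^ (-M : ℝ)‖ₑ := by
    refine (enorm_add_le _ _).trans ?_
    rw [enorm_norm, enorm_mul, Real.enorm_of_nonneg (r := e * t⁻¹) (by positivity)]
  simp only [h1]
  rw [← ENNReal.mul_rpow_of_nonneg _ _ hr₀]
  exact (ENNReal.rpow_le_rpow h2 hr₀).trans (ENNReal.rpow_add_le_add_rpow _ _ hr₀ hr₁)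

/-- This invariance allows boundedness on `X` to be applied to all dilates of `f` with one constant.
-/
theorem hausdorff_comp_smul (Φ f : Rn n → ℂ) (c : ℝ) (x : Rn n) :
    hausdorff Φ (fun y => f (c • y)) x = hausdorff Φ f (c • x) := by
  simp only [hausdorff, smul_comm c]

theorem testAwayFromZero_comp_smul {f : Rn n → ℂ} (hf : f ∈ testAwayFromZero n) {c : ℝ}
    (hc : c ≠ 0) : (fun x => f (c • x)) ∈ testAwayFromZero n := by
  refine ⟨hf.1.comp (contDiff_const_smul c), hf.2.1.comp_smul hc, fun h => hf.2.2 ?_⟩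
  have h1 := tsupport_comp_subset_preimage f (f := fun x : Rn n => c • x) (by fun_prop) h
  simpa using h1

/-- Boundedness is applied to `f(·/(k+1))`, both sides are divided by `(k+1)^n`, and `k → ∞`.
Continuity of `H_Φ f` off the origin is required because low-frequency pieces recover a function at
its points of continuity. -/
theorem exists_lintegral_hausdorff_le (hn : 0 < n) {p : ℝ≥0∞} (hp₀ : 0 < p) (hp₁ : p < 1)
    {N : 𝓢'(Rn n, ℂ) → ℝ≥0∞} (hN : IsAdmissibleNorm p N) {Φ : Rn n → ℂ} {𝒟 : Set (Rn n → ℂ)}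
    (h𝒟 : testAwayFromZero n ⊆ 𝒟) (hb : IsBoundedOn Φ 𝒟 N) :
    ∃ C : ℝ≥0∞, C ≠ ⊤ ∧ ∀ f ∈ testAwayFromZero n, ContinuousOn (hausdorff Φ f) {0}ᶜ →
      ∫⁻ x, ‖hausdorff Φ f x‖ₑ ^ p.toReal ≤ C * ∫⁻ x, ‖f x‖ₑ ^ p.toReal := by
  have hptop : p ≠ ⊤ := (hp₁.trans ENNReal.one_lt_top).ne
  set r := p.toReal with hr
  have hr₀ : 0 < r := ENNReal.toReal_pos hp₀.ne' hptop
  have hr₁ : r ≤ 1 := by simpa using ENNReal.toReal_mono ENNReal.one_ne_top hp₁.le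
  -- `M` makes `(1 + ‖x‖)⁻ᴹ` belong to `L^p`, so the error term of the envelope has finite norm.
  obtain ⟨M, hM⟩ := Measure.HasTemperateGrowth.exists_eLpNorm_lt_top (E := Rn n) p
    (μ := volume) inferInstance
  obtain ⟨m, hm0, hlow⟩ := hN.lower
  obtain ⟨D, hup⟩ := hN.upper M
  obtain ⟨C₀, hC₀⟩ := hb
  set W : ℝ≥0∞ := ∫⁻ x : Rn n, ‖(1 + ‖x‖) ^ (-M : ℝ)‖ₑ ^ r with hW
  have hWtop : W ≠ ⊤ := by
    rw [hW, ← eLpNorm_rpow_toReal hp₀.ne' hptop]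
    exact ENNReal.rpow_ne_top_of_nonneg hr₀.le hM.ne
  set A : ℝ≥0∞ := ((C₀ : ℝ≥0∞) * D) ^ r with hA
  have hAtop : A ≠ ⊤ := ENNReal.rpow_ne_top_of_nonneg hr₀.le (by finiteness)
  refine ⟨A, hAtop, fun f hf hcont => ?_⟩
  let fS : 𝓢(Rn n, ℂ) := hf.2.1.toSchwartzMap hf.1
  obtain ⟨e, he, hN'⟩ := hup fS
  have ht : ∀ k : ℕ, (0 : ℝ) < (k : ℝ) + 1 := fun k => by positivity
  have ht1 : ∀ k : ℕ, (1 : ℝ) ≤ (k : ℝ) + 1 := fun k => by linarith [k.cast_nonneg (α := ℝ)]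
  have hI : ∫⁻ x, ‖f x‖ₑ ^ r ≠ ⊤ := by
    have h1 := fS.eLpNorm_lt_top p volume
    have h2 : ∫⁻ x, ‖fS x‖ₑ ^ r ≠ ⊤ := by
      rw [← eLpNorm_rpow_toReal hp₀.ne' hptop]
      exact ENNReal.rpow_ne_top_of_nonneg hr₀.le h1.ne
    exact h2
  have henv := fun k : ℕ => lintegral_envelope_le (n := n) hr₀.le hr₁ hf.1.continuous M he (ht k)
  have henvtop : ∀ k : ℕ, eLpNorm (envelope fS M e ((k : ℝ) + 1)) p volume ≠ ⊤ := by
    intro k h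
    have h1 := eLpNorm_rpow_toReal hp₀.ne' hptop (envelope fS M e ((k : ℝ) + 1))
    rw [h, ENNReal.top_rpow_of_pos hr₀] at h1
    have h2 := henv k
    have h3 : ∫⁻ x, ‖envelope f M e ((k : ℝ) + 1) x‖ₑ ^ r = ⊤ := h1.symm
    rw [h3, ENNReal.mul_top (by simpa using pow_pos (ht k) n), top_le_iff] at h2
    exact ENNReal.add_ne_top.mpr ⟨hI, ENNReal.mul_ne_top
      (ENNReal.rpow_ne_top_of_nonneg hr₀.le ENNReal.ofReal_ne_top) hWtop⟩ h2
  have hex : ∀ k : ℕ, ∃ v : 𝓢'(Rn n, ℂ), ∃ F : Rn n → ℂ,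
      Represents (fun x => hausdorff Φ f (((k : ℝ) + 1)⁻¹ • x)) v ∧
      Represents F (TemperedDistribution.fourierMultiplierCLM ℂ (fun ξ => m ξ) v) ∧
      eLpNorm F p volume ≤ C₀ * D * eLpNorm (envelope fS M e ((k : ℝ) + 1)) p volume := by
    intro k
    have hne : ((k : ℝ) + 1)⁻¹ ≠ 0 := inv_ne_zero (ht k).ne'
    have hdil : ⇑(dil ((k : ℝ) + 1)⁻¹ fS) = fun x => f (((k : ℝ) + 1)⁻¹ • x) := coe_dil hne fS
    have hu := hN' _ (ht1 k)
    have hfin : N (dil ((k : ℝ) + 1)⁻¹ fS : 𝓢'(Rn n, ℂ)) < ⊤ :=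
      hu.trans_lt (ENNReal.mul_lt_top ENNReal.coe_lt_top (henvtop k).lt_top)
    obtain ⟨v, hv, hle⟩ := hC₀ _ (h𝒟 (testAwayFromZero_comp_smul hf hne)) _
      (hdil ▸ represents_schwartz (dil ((k : ℝ) + 1)⁻¹ fS)) hfin
    have hle2 : distLpNorm p (TemperedDistribution.fourierMultiplierCLM ℂ (fun ξ => m ξ) v) ≤
        C₀ * D * eLpNorm (envelope fS M e ((k : ℝ) + 1)) p volume := by
      rw [mul_assoc]
      exact (hlow v).trans (hle.trans (by gcongr))
    obtain ⟨F, hF, hFeq⟩ := exists_represents_eLpNorm_eq m (hle2.trans_lt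
      (ENNReal.mul_lt_top (by finiteness) (henvtop k).lt_top))
    refine ⟨v, F, ?_, hF, hFeq.trans_le hle2⟩
    have h1 : hausdorff Φ (fun y => f (((k : ℝ) + 1)⁻¹ • y)) =
        fun x => hausdorff Φ f (((k : ℝ) + 1)⁻¹ • x) :=
      funext fun x => hausdorff_comp_smul Φ f _ x
    rwa [h1] at hv
  choose v F hv hF hFle using hex
  refine (lintegral_le_liminf_of_represents hn hcont m hm0 v hv F hF (r := r)).trans ?_
  have hlim : Tendsto (fun k : ℕ => A * ((∫⁻ x, ‖f x‖ₑ ^ r) +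
      ENNReal.ofReal (e * ((k : ℝ) + 1)⁻¹) ^ r * W)) atTop (𝓝 (A * ∫⁻ x, ‖f x‖ₑ ^ r)) := by
    have h1 : Tendsto (fun k : ℕ => e * ((k : ℝ) + 1)⁻¹) atTop (𝓝 0) := by
      simpa using (tendsto_one_div_add_atTop_nhds_zero_nat (𝕜 := ℝ)).const_mul e
    have h2 : Tendsto (fun k : ℕ => ENNReal.ofReal (e * ((k : ℝ) + 1)⁻¹) ^ r) atTop (𝓝 0) := by
      have h3 := (ENNReal.continuous_rpow_const (y := r)).tendsto (ENNReal.ofReal 0) |>.comp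
        ((ENNReal.continuous_ofReal.tendsto 0).comp h1)
      simpa [ENNReal.zero_rpow_of_pos hr₀] using! h3
    have h4 := ENNReal.Tendsto.mul_const h2 (Or.inr hWtop)
    rw [zero_mul] at h4
    have h5 := ENNReal.Tendsto.const_mul (h4.const_add (∫⁻ x, ‖f x‖ₑ ^ r)) (Or.inr hAtop)
    rwa [add_zero] at h5
  rw [← hlim.liminf_eq]
  refine liminf_le_liminf (Eventually.of_forall fun k => ?_)
  have h1 : ∫⁻ x, ‖F k x‖ₑ ^ r ≤ A * ∫⁻ x, ‖envelope f M e ((k : ℝ) + 1) x‖ₑ ^ r := by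
    have h2 := ENNReal.rpow_le_rpow (hFle k) hr₀.le
    rw [ENNReal.mul_rpow_of_nonneg _ _ hr₀.le, eLpNorm_rpow_toReal hp₀.ne' hptop,
      eLpNorm_rpow_toReal hp₀.ne' hptop] at h2
    exact h2
  calc _ ≤ ENNReal.ofReal (((k : ℝ) + 1) ^ n)⁻¹ *
        (A * ∫⁻ x, ‖envelope f M e ((k : ℝ) + 1) x‖ₑ ^ r) := by gcongr
    _ = A * (ENNReal.ofReal (((k : ℝ) + 1) ^ n)⁻¹ *
        ∫⁻ x, ‖envelope f M e ((k : ℝ) + 1) x‖ₑ ^ r) := by ring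
    _ ≤ _ := by gcongr; exact henv k

/-! ### The dyadic symbols -/

theorem lqNorm_ne_top_of_le {ι : Type} {q : ℝ≥0∞} (hq : 0 < q) {a : ι → ℝ≥0∞} {b : ι → ℝ} {B : ℝ}
    (hb₀ : ∀ i, 0 ≤ b i) (hb₁ : ∀ i, b i ≤ 1) (hsum : q ≠ ⊤ → Summable fun i => b i ^ q.toReal)
    (h : ∀ i, a i ≤ ENNReal.ofReal (b i * B)) : lqNorm q a ≠ ⊤ := by
  have h1 : lqNorm q a ≤ lqNorm q (fun i => ENNReal.ofReal (b i)) * ENNReal.ofReal B := by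
    rw [← lqNorm_mul_const hq]
    exact lqNorm_mono q fun i => (h i).trans (ENNReal.ofReal_mul (hb₀ i)).le
  refine ne_top_of_le_ne_top (ENNReal.mul_ne_top ?_ ENNReal.ofReal_ne_top) h1
  unfold lqNorm
  split_ifs with hqt
  · refine ne_top_of_le_ne_top ENNReal.one_ne_top (iSup_le fun i => ?_)
    simpa using hb₁ i
  · refine ENNReal.rpow_ne_top_of_nonneg (by positivity) ?_
    have hq0 : 0 < q.toReal := ENNReal.toReal_pos hq.ne' hqt
    simp_rw [ENNReal.ofReal_rpow_of_nonneg (hb₀ _) hq0.le]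
    exact (hsum hqt).tsum_ofReal_ne_top

/-- For `j ≥ 1` both terms of `φ_j` equal 1 when `‖ξ‖ ≤ (4/3) 2^{j-1}`, in particular on the ball of
radius `2^j / 2`. The derivative bounds are uniform since every term is `φ` composed with a
contraction. -/
theorem IsDyadicBump.isSymbolFamily {φ : Rn n → ℝ} (hφ : IsDyadicBump φ) :
    IsSymbolFamily 0 (fun j ξ => (dyadicSymbol φ j ξ : ℂ)) (fun j : ℕ => (2 : ℝ) ^ j / 2) := by
  let ψ : Rn n → ℂ := fun ξ => (φ ξ : ℂ)
  have hψ : ContDiff ℝ ∞ ψ := Complex.ofRealCLM.contDiff.comp hφ.smooth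
  have hψc : HasCompactSupport ψ := by
    refine HasCompactSupport.of_support_subset_isCompact
      (isCompact_closedBall (0 : Rn n) (3 / 2)) ?_
    refine subset_trans (fun ξ hξ => ?_) (hφ.support_subset.trans Metric.ball_subset_closedBall)
    exact fun h => hξ (by simp [ψ, h])
  obtain ⟨K, hK⟩ := exists_bound_iteratedFDeriv hψ hψc
  have hsucc : ∀ j : ℕ, (fun ξ => (dyadicSymbol φ (j + 1) ξ : ℂ)) =
      (fun ξ => ψ (((2 : ℝ) ^ (j + 1))⁻¹ • ξ)) - fun ξ => ψ (((2 : ℝ) ^ j)⁻¹ • ξ) := by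
    intro j
    funext ξ
    have h1 : (2 : ℝ) • ((2 : ℝ) ^ (j + 1))⁻¹ • ξ = ((2 : ℝ) ^ j)⁻¹ • ξ := by
      rw [smul_smul, pow_succ, mul_inv_rev, mul_inv_cancel_left₀ two_ne_zero]
    simp only [dyadicSymbol, ψ, Pi.sub_apply, Complex.ofReal_sub, h1]
  have hs : ∀ j : ℕ, ContDiff ℝ ∞ (fun ξ => ψ (((2 : ℝ) ^ j)⁻¹ • ξ)) := fun j =>
    hψ.comp (contDiff_const_smul _)
  have hcs : ∀ j : ℕ, HasCompactSupport (fun ξ => ψ (((2 : ℝ) ^ j)⁻¹ • ξ)) := fun j =>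
    hψc.comp_smul (by positivity)
  have hbd : ∀ i j ξ, ‖iteratedFDeriv ℝ j (fun ξ => ψ (((2 : ℝ) ^ i)⁻¹ • ξ)) ξ‖ ≤ K j := fun i =>
    norm_iteratedFDeriv_comp_smul_le hψ hK (by positivity)
      (inv_le_one_of_one_le₀ (one_le_pow₀ one_le_two))
  refine ⟨fun i => ?_, fun i => ?_, ⟨fun j => K j + K j, fun i j ξ => ?_⟩, fun i => by positivity,
    by norm_num, fun i hi ξ hξ => ?_, fun ξ hξ => ?_⟩
  · cases i with
    | zero => exact hψ
    | succ i => rw [hsucc]; exact (hs _).sub (hs _)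
  · cases i with
    | zero => exact hψc
    | succ i => rw [hsucc]; exact (hcs _).sub (hcs _)
  · cases i with
    | zero => exact (hK j ξ).trans (by linarith [(norm_nonneg _).trans (hK j ξ)])
    | succ i =>
      rw [hsucc, iteratedFDeriv_sub_apply ((hs _).of_le (by exact_mod_cast le_top)).contDiffAt
        ((hs _).of_le (by exact_mod_cast le_top)).contDiffAt]
      exact (norm_sub_le _ _).trans (add_le_add (hbd _ j ξ) (hbd _ j ξ))
  · obtain ⟨i, rfl⟩ := Nat.exists_eq_succ_of_ne_zero hi
    have h2 : (0 : ℝ) < 2 ^ i := by positivity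
    have hξ' : ‖ξ‖ < 2 ^ i := by
      have : (2 : ℝ) ^ (i + 1) / 2 = 2 ^ i := by rw [pow_succ]; ring
      rwa [Nat.succ_eq_add_one, this] at hξ
    have key : ∀ k, i ≤ k → ψ (((2 : ℝ) ^ k)⁻¹ • ξ) = 1 := by
      intro k hk
      have : (2 : ℝ) ^ i ≤ 2 ^ k := pow_le_pow_right₀ one_le_two hk
      have h3 : ‖((2 : ℝ) ^ k)⁻¹ • ξ‖ ≤ 4 / 3 := by
        rw [norm_smul, norm_inv, Real.norm_of_nonneg (by positivity),
          inv_mul_le_iff₀ (by positivity)]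
        nlinarith
      simp [ψ, hφ.eq_one _ h3]
    have h4 := congrFun (hsucc i) ξ
    simp only [Nat.succ_eq_add_one]
    rw [h4, Pi.sub_apply, key _ (by omega), key _ le_rfl, sub_self]
  · have : φ ξ = 1 := hφ.eq_one ξ (by norm_num at hξ; linarith)
    simp [dyadicSymbol, this]

/-- The power `⌈|s|⌉` beats the weight `2^{js}`; the extra power leaves the geometric factor
`2^{-j}`, which is bounded and `q`-summable. -/
theorem lqNorm_dyadic_ne_top {q : ℝ≥0∞} (hq : 0 < q) (s : ℝ) :
    lqNorm q (fun j : ℕ => (2 : ℝ≥0∞) ^ ((j : ℝ) * s) *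
      ENNReal.ofReal (((2 : ℝ) ^ j / 2)⁻¹ ^ (⌈|s|⌉₊ + 1))) ≠ ⊤ := by
  refine lqNorm_ne_top_of_le hq (b := fun j : ℕ => (1 / 2 : ℝ) ^ j) (B := 2 ^ (⌈|s|⌉₊ + 1))
    (fun j => by positivity) (fun j => pow_le_one₀ (by norm_num) (by norm_num)) (fun hqt => ?_)
    fun j => ?_
  · have hq0 : 0 < q.toReal := ENNReal.toReal_pos hq.ne' hqt
    have h1 : ∀ j : ℕ, ((1 / 2 : ℝ) ^ j) ^ q.toReal = ((1 / 2 : ℝ) ^ q.toReal) ^ j := fun j => by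
      rw [← Real.rpow_natCast, ← Real.rpow_mul (by norm_num), mul_comm, Real.rpow_mul (by norm_num),
        Real.rpow_natCast]
    simp_rw [h1]
    exact summable_geometric_of_lt_one (by positivity) (Real.rpow_lt_one (by norm_num)
      (by norm_num) hq0)
  · have h1 : (2 : ℝ≥0∞) ^ ((j : ℝ) * s) = ENNReal.ofReal ((2 : ℝ) ^ ((j : ℝ) * s)) := by
      rw [← ENNReal.ofReal_rpow_of_pos two_pos, ENNReal.ofReal_ofNat]
    rw [h1, ← ENNReal.ofReal_mul (by positivity)]
    refine ENNReal.ofReal_le_ofReal ?_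
    set S := ⌈|s|⌉₊ with hS
    have h2 : (2 : ℝ) ^ ((j : ℝ) * s) ≤ (2 ^ j) ^ S := by
      rw [← pow_mul, ← Real.rpow_natCast]
      refine Real.rpow_le_rpow_of_exponent_le one_le_two ?_
      push_cast
      have : s ≤ S := (le_abs_self s).trans (Nat.le_ceil _)
      gcongr
    have h3 : ((2 : ℝ) ^ j / 2)⁻¹ ^ (S + 1) = 2 ^ (S + 1) * ((2 ^ j) ^ S * 2 ^ j)⁻¹ := by
      rw [inv_div, div_pow, div_eq_mul_inv, pow_succ ((2 : ℝ) ^ j)]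
    calc _ ≤ ((2 : ℝ) ^ j) ^ S * (2 ^ (S + 1) * ((2 ^ j) ^ S * 2 ^ j)⁻¹) := by
          rw [h3]; gcongr
      _ = _ := by
          rw [one_div, inv_pow]
          field_simp

theorem isAdmissibleNorm_besovNorm {φ : Rn n → ℝ} (hφ : IsDyadicBump φ) (p : ℝ≥0∞) {q : ℝ≥0∞}
    (hq : 0 < q) (s : ℝ) : IsAdmissibleNorm p (besovNorm φ p q s) :=
  hφ.isSymbolFamily.isAdmissibleNorm_lqLp (w := fun j : ℕ => (2 : ℝ≥0∞) ^ ((j : ℝ) * s)) hq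
    (by simp) (by omega) (lqNorm_dyadic_ne_top hq s)

theorem isAdmissibleNorm_triebelLizorkinNorm {φ : Rn n → ℝ} (hφ : IsDyadicBump φ) (p : ℝ≥0∞)
    {q : ℝ≥0∞} (hq : 0 < q) (s : ℝ) : IsAdmissibleNorm p (triebelLizorkinNorm φ p q s) :=
  hφ.isSymbolFamily.isAdmissibleNorm_Lplq (w := fun j : ℕ => (2 : ℝ≥0∞) ^ ((j : ℝ) * s)) hq
    (by simp) (by omega) (lqNorm_dyadic_ne_top hq s)

/-! ### The uniform symbols -/

theorem latticePt_apply (k : Fin n → ℤ) (i : Fin n) : latticePt k i = k i := rfl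

theorem latticePt_add (k l : Fin n → ℤ) : latticePt (k + l) = latticePt k + latticePt l := by
  ext i
  simp [latticePt_apply]

theorem latticePt_zero : latticePt (0 : Fin n → ℤ) = 0 := by
  ext i
  simp [latticePt_apply]

theorem norm_le_of_forall_abs_le {x : Rn n} {c : ℝ} (hc : 0 ≤ c) (h : ∀ i, |x i| ≤ c) :
    ‖x‖ ≤ n * c := by
  rw [EuclideanSpace.norm_eq]
  refine Real.sqrt_le_iff.mpr ⟨by positivity, ?_⟩
  calc ∑ i, ‖x i‖ ^ 2 ≤ ∑ _i : Fin n, c ^ 2 := by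
        refine Finset.sum_le_sum fun i _ => ?_
        rw [Real.norm_eq_abs]
        gcongr
        exact h i
    _ = n * c ^ 2 := by simp
    _ ≤ (n * c) ^ 2 := by
        rw [mul_pow]
        gcongr
        rcases Nat.eq_zero_or_pos n with rfl | hn
        · simp
        · have : (1 : ℝ) ≤ n := by exact_mod_cast hn
          nlinarith

theorem abs_apply_le_norm (x : Rn n) (i : Fin n) : |x i| ≤ ‖x‖ := by
  simpa using PiLp.norm_apply_le x i

namespace IsUniformBump

variable {η : Rn n → ℝ}

theorem abs_lt_of_ne_zero (hη : IsUniformBump η) {ξ : Rn n} (h : η ξ ≠ 0) (i : Fin n) :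
    |ξ i| < 3 / 4 := by
  by_contra hi
  exact h (hη.eq_zero ξ ⟨i, not_lt.mp hi⟩)

/-- The sum of all integer translates of `η`. -/
def translateSum (η : Rn n → ℝ) (ξ : Rn n) : ℝ := ∑' l : Fin n → ℤ, η (ξ - latticePt l)

/-- A finite set of lattice points that contains all those near `ξ`. -/
def nearLattice (ξ : Rn n) : Finset (Fin n → ℤ) :=
  Fintype.piFinset fun i => Finset.Icc ⌊ξ i - 2⌋ ⌈ξ i + 2⌉

theorem eq_zero_of_notMem_nearLattice (hη : IsUniformBump η) {ξ₀ ξ : Rn n} (hξ : ‖ξ - ξ₀‖ < 1)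
    {l : Fin n → ℤ} (hl : l ∉ nearLattice ξ₀) : η (ξ - latticePt l) = 0 := by
  by_contra h
  refine hl (Fintype.mem_piFinset.mpr fun i => Finset.mem_Icc.mpr ?_)
  -- Each coordinate of `l` is within `3/4 + 1 < 2` of that of `ξ₀`.
  have h1 := abs_lt.mp (hη.abs_lt_of_ne_zero h i)
  have h2 := abs_lt.mp ((abs_apply_le_norm (ξ - ξ₀) i).trans_lt hξ)
  simp only [PiLp.sub_apply, latticePt_apply] at h1 h2
  constructor
  · have : (⌊ξ₀ i - 2⌋ : ℝ) < l i + 1 := (Int.floor_le _).trans_lt (by linarith)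
    exact Int.lt_add_one_iff.mp (by exact_mod_cast this)
  · have : (l i : ℝ) < ⌈ξ₀ i + 2⌉ + 1 := lt_of_lt_of_le (by linarith)
      (add_le_add_left (Int.le_ceil (ξ₀ i + 2)) 1)
    exact Int.lt_add_one_iff.mp (by exact_mod_cast this)

theorem contDiff_translateSum (hη : IsUniformBump η) : ContDiff ℝ ∞ (translateSum η) := by
  rw [contDiff_iff_contDiffAt]
  intro ξ₀
  have h1 : ContDiff ℝ ∞ fun ξ => ∑ l ∈ nearLattice ξ₀, η (ξ - latticePt l) :=
    ContDiff.sum fun l _ => hη.smooth.comp (contDiff_id.sub contDiff_const)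
  refine h1.contDiffAt.congr_of_eventuallyEq ?_
  filter_upwards [Metric.ball_mem_nhds ξ₀ one_pos] with ξ hξ
  exact tsum_eq_sum fun l hl =>
    hη.eq_zero_of_notMem_nearLattice (by rwa [← dist_eq_norm]) hl

theorem one_le_translateSum (hη : IsUniformBump η) (ξ : Rn n) : 1 ≤ translateSum η ξ := by
  let l₀ : Fin n → ℤ := fun i => round (ξ i)
  have h1 : η (ξ - latticePt l₀) = 1 := hη.eq_one _ fun i => by
    simpa [latticePt_apply, l₀] using abs_sub_round (ξ i)
  have hs : Summable fun l : Fin n → ℤ => η (ξ - latticePt l) :=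
    summable_of_ne_finset_zero (s := nearLattice ξ) fun l hl =>
      hη.eq_zero_of_notMem_nearLattice (by simp) hl
  rw [← h1]
  exact hs.le_tsum l₀ fun l _ => (hη.mem_Icc _).1

theorem translateSum_sub (η : Rn n → ℝ) (ξ : Rn n) (k : Fin n → ℤ) :
    translateSum η (ξ - latticePt k) = translateSum η ξ := by
  unfold translateSum
  rw [← (Equiv.addLeft k).tsum_eq (fun l => η (ξ - latticePt l))]
  congr 1 with l
  rw [Equiv.coe_addLeft, latticePt_add, sub_sub]

theorem uniformSymbol_eq (η : Rn n → ℝ) (k : Fin n → ℤ) (ξ : Rn n) :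
    uniformSymbol η k ξ = uniformSymbol η 0 (ξ - latticePt k) := by
  unfold uniformSymbol
  rw [latticePt_zero, sub_zero]
  congr 1
  exact (translateSum_sub η ξ k).symm

theorem contDiff_uniformSymbol (hη : IsUniformBump η) (k : Fin n → ℤ) :
    ContDiff ℝ ∞ (uniformSymbol η k) :=
  (hη.smooth.comp (contDiff_id.sub contDiff_const)).div hη.contDiff_translateSum fun ξ =>
    (one_pos.trans_le (hη.one_le_translateSum ξ)).ne'

theorem hasCompactSupport_uniformSymbol (hη : IsUniformBump η) (k : Fin n → ℤ) :
    HasCompactSupport (uniformSymbol η k) := by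
  refine HasCompactSupport.of_support_subset_isCompact
    (isCompact_closedBall (latticePt k) (n * (3 / 4))) fun ξ hξ => ?_
  have h1 : η (ξ - latticePt k) ≠ 0 := fun h => hξ (by simp [uniformSymbol, h])
  rw [Metric.mem_closedBall, dist_eq_norm]
  exact norm_le_of_forall_abs_le (by norm_num) fun i => (hη.abs_lt_of_ne_zero h1 i).le

/-- If `‖ξ‖ ≤ 1/4` and `l ≠ 0`, some coordinate of `ξ - l` is at least `1 - 1/4 = 3/4` in modulus,
so only the translate `l = 0` contributes to the denominator. -/
theorem uniformSymbol_zero_eq_one (hη : IsUniformBump η) {ξ : Rn n} (hξ : ‖ξ‖ ≤ 1 / 4) :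
    uniformSymbol η 0 ξ = 1 := by
  have hξi : ∀ i, |ξ i| ≤ 1 / 4 := fun i => (abs_apply_le_norm ξ i).trans hξ
  have h1 : η ξ = 1 := hη.eq_one ξ fun i => (hξi i).trans (by norm_num)
  have h2 : translateSum η ξ = 1 := by
    unfold translateSum
    rw [tsum_eq_single 0, latticePt_zero, sub_zero, h1]
    intro l hl
    obtain ⟨i, hi⟩ := Function.ne_iff.mp hl
    refine hη.eq_zero _ ⟨i, ?_⟩
    have h3 : (1 : ℝ) ≤ |(l i : ℝ)| := by exact_mod_cast Int.one_le_abs hi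
    have h4 := abs_sub_abs_le_abs_sub (l i : ℝ) (ξ i)
    rw [PiLp.sub_apply, latticePt_apply, abs_sub_comm]
    linarith [hξi i]
  have h5 : uniformSymbol η 0 ξ = η (ξ - latticePt 0) / translateSum η ξ := rfl
  rw [h5, h2, latticePt_zero, sub_zero, h1, div_one]

/-- All symbols are translates of `σ_0`, hence the uniform derivative bounds. If `σ_k(ξ) ≠ 0` and `k
i` is the largest coordinate in modulus, then `‖ξ‖ ≥ |k i| - 3/4 ≥ |k i| / 4`, while `1 + ‖k‖ ≤ 2n
|k i|`; this is the source of `8n`. -/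
theorem isSymbolFamily (hη : IsUniformBump η) (hn : 0 < n) :
    IsSymbolFamily 0 (fun k ξ => (uniformSymbol η k ξ : ℂ))
      (fun k : Fin n → ℤ => (1 + ‖latticePt k‖) / (8 * n)) := by
  have hn' : (1 : ℝ) ≤ n := by exact_mod_cast hn
  have hsm : ∀ k, ContDiff ℝ ∞ fun ξ => (uniformSymbol η k ξ : ℂ) := fun k =>
    Complex.ofRealCLM.contDiff.comp (hη.contDiff_uniformSymbol k)
  have hcs : ∀ k, HasCompactSupport fun ξ => (uniformSymbol η k ξ : ℂ) := fun k =>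
    (hη.hasCompactSupport_uniformSymbol k).comp_left (g := fun r : ℝ => (r : ℂ))
      Complex.ofReal_zero
  obtain ⟨K, hK⟩ := exists_bound_iteratedFDeriv (hsm 0) (hcs 0)
  refine ⟨hsm, hcs, ⟨K, fun k j ξ => ?_⟩, fun k => by positivity, ?_, fun k hk ξ hξ => ?_,
    fun ξ hξ => ?_⟩
  · have h1 : (fun ξ => (uniformSymbol η k ξ : ℂ)) =
        fun ξ => (fun ξ => (uniformSymbol η 0 ξ : ℂ)) (ξ - latticePt k) :=
      funext fun ξ => by rw [uniformSymbol_eq]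
    rw [h1, iteratedFDeriv_comp_sub (f := fun ξ => (uniformSymbol η 0 ξ : ℂ))]
    exact hK j _
  · rw [latticePt_zero, norm_zero, add_zero, div_le_one (by positivity)]
    linarith
  · by_contra h
    have h1 : η (ξ - latticePt k) ≠ 0 := fun h0 => h (by simp [uniformSymbol, h0])
    have : Nonempty (Fin n) := ⟨⟨0, hn⟩⟩
    obtain ⟨i, hi⟩ := Finite.exists_max fun i => |(k i : ℝ)|
    have hk1 : (1 : ℝ) ≤ |(k i : ℝ)| := by
      obtain ⟨i', hi'⟩ := Function.ne_iff.mp hk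
      have : (1 : ℝ) ≤ |(k i' : ℝ)| := by exact_mod_cast Int.one_le_abs hi'
      exact this.trans (hi i')
    have hk2 : ‖latticePt k‖ ≤ n * |(k i : ℝ)| := norm_le_of_forall_abs_le (abs_nonneg _) hi
    have h2 := hη.abs_lt_of_ne_zero h1 i
    rw [PiLp.sub_apply, latticePt_apply, abs_sub_comm] at h2
    have h3 := abs_sub_abs_le_abs_sub (k i : ℝ) (ξ i)
    have h4 := abs_apply_le_norm ξ i
    rw [lt_div_iff₀ (by positivity)] at hξ
    have h5 : |(k i : ℝ)| / 4 ≤ ‖ξ‖ := by linarith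
    nlinarith
  · rw [latticePt_zero, norm_zero, add_zero, lt_div_iff₀ (by positivity)] at hξ
    have : ‖ξ‖ ≤ 1 / 4 := by nlinarith [norm_nonneg ξ]
    simp [hη.uniformSymbol_zero_eq_one this]

end IsUniformBump

/-! ### Summability of the weights over the lattice. -/

theorem summable_one_add_norm_latticePt {r : ℝ} (hr : r < -n) :
    Summable fun k : Fin n → ℤ => (1 + ‖latticePt k‖) ^ r := by
  let b := (EuclideanSpace.basisFun (Fin n) ℝ).toBasis
  let L : Submodule ℤ (Rn n) := Submodule.span ℤ (Set.range b)
  have hrank : Module.finrank ℤ L = n := by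
    rw [ZLattice.rank ℝ L, finrank_euclideanSpace_fin]
  have hmem : ∀ k : Fin n → ℤ, latticePt k ∈ L := by
    intro k
    have h1 : latticePt k = ∑ i, k i • b i := by
      ext j
      simp [b, latticePt_apply, Finset.sum_apply, Pi.single_apply]
    rw [h1]
    exact Submodule.sum_mem _ fun i _ =>
      Submodule.smul_mem _ _ (Submodule.subset_span (Set.mem_range_self i))
  have hinj : Function.Injective fun k : Fin n → ℤ => (⟨latticePt k, hmem k⟩ : L) := by
    intro k l h
    funext i
    have h1 : latticePt k i = latticePt l i := by rw [Subtype.mk.inj h]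
    simpa [latticePt_apply] using h1
  have hsum := (ZLattice.summable_norm_rpow L r (by rwa [hrank])).comp_injective hinj
  -- The comparison with `‖k‖^r` is made off the single point `k = 0`.
  refine Summable.of_norm_bounded_eventually hsum ?_
  refine (Set.finite_singleton (0 : Fin n → ℤ)).subset fun k hk => ?_
  by_contra hk0
  refine hk ?_
  have hpos : 0 < ‖latticePt k‖ := by
    rw [norm_pos_iff]
    intro h
    refine hk0 (funext fun i => ?_)
    have : latticePt k i = 0 := by rw [h]; rfl
    simpa [latticePt_apply] using this
  have hr0 : r ≤ 0 := hr.le.trans (by simp)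
  change ‖(1 + ‖latticePt k‖) ^ r‖ ≤ ‖latticePt k‖ ^ r
  rw [Real.norm_of_nonneg (by positivity)]
  exact Real.rpow_le_rpow_of_nonpos hpos (by linarith) hr0

theorem exists_lqNorm_uniform_ne_top (hn : 0 < n) {q : ℝ≥0∞} (hq : 0 < q) (s : ℝ) :
    ∃ P : ℕ, 1 ≤ P ∧ lqNorm q (fun k : Fin n → ℤ =>
      ENNReal.ofReal ((1 + ‖latticePt k‖ ^ 2) ^ (s / 2)) *
        ENNReal.ofReal (((1 + ‖latticePt k‖) / (8 * n))⁻¹ ^ P)) ≠ ⊤ := by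
  -- `R` makes the `q`-th powers summable over the lattice, and `S` beats the weight `⟨k⟩^s`. For `q
  -- = ∞`, division by 0 gives `R = 0`, and no summability is required.
  set R : ℕ := ⌈((n : ℝ) + 1) / q.toReal⌉₊ with hR
  set S : ℕ := ⌈|s|⌉₊ with hS
  refine ⟨S + R + 1, by omega, ?_⟩
  have hx : ∀ k : Fin n → ℤ, 1 ≤ 1 + ‖latticePt k‖ := fun k => by simp
  refine lqNorm_ne_top_of_le hq (b := fun k : Fin n → ℤ => ((1 + ‖latticePt k‖) ^ R)⁻¹)
    (B := (8 * n) ^ (S + R + 1)) (fun k => by positivity)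
    (fun k => inv_le_one_of_one_le₀ (one_le_pow₀ (hx k))) (fun hqt => ?_) fun k => ?_
  · have hq0 : 0 < q.toReal := ENNReal.toReal_pos hq.ne' hqt
    have h1 : ∀ k : Fin n → ℤ, (((1 + ‖latticePt k‖) ^ R)⁻¹) ^ q.toReal =
        (1 + ‖latticePt k‖) ^ (-(R * q.toReal)) := fun k => by
      rw [← Real.rpow_natCast, ← Real.rpow_neg (by positivity), ← Real.rpow_mul (by positivity)]
      congr 1
      ring
    simp_rw [h1]
    refine summable_one_add_norm_latticePt ?_
    have h2 : ((n : ℝ) + 1) / q.toReal ≤ R := Nat.le_ceil _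
    rw [div_le_iff₀ hq0] at h2
    linarith
  · rw [← ENNReal.ofReal_mul (by positivity)]
    refine ENNReal.ofReal_le_ofReal ?_
    set x := ‖latticePt k‖ with hxd
    have hx0 : 0 ≤ x := norm_nonneg _
    have h1 : (1 + x ^ 2) ^ (s / 2) ≤ (1 + x) ^ S := by
      calc (1 + x ^ 2) ^ (s / 2) ≤ (1 + x ^ 2) ^ ((S : ℝ) / 2) := by
            refine Real.rpow_le_rpow_of_exponent_le (by nlinarith) ?_
            have : s ≤ S := (le_abs_self s).trans (Nat.le_ceil _)
            linarith
        _ ≤ ((1 + x) ^ 2) ^ ((S : ℝ) / 2) := by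
            refine Real.rpow_le_rpow (by positivity) (by nlinarith) (by positivity)
        _ = (1 + x) ^ S := by
            rw [← Real.rpow_natCast, ← Real.rpow_mul (by positivity), ← Real.rpow_natCast]
            congr 1
            push_cast
            ring
    have h2 : ((1 + x) / (8 * n))⁻¹ ^ (S + R + 1) =
        (8 * n) ^ (S + R + 1) * ((1 + x) ^ S * (1 + x) ^ R * (1 + x))⁻¹ := by
      rw [inv_div, div_pow, div_eq_mul_inv, pow_succ (1 + x), pow_add (1 + x)]
    have hn' : (0 : ℝ) < n := by exact_mod_cast hn
    calc _ ≤ (1 + x) ^ S * ((8 * n) ^ (S + R + 1) * ((1 + x) ^ S * (1 + x) ^ R * (1 + x))⁻¹) := by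
          rw [h2]; gcongr
      _ = ((1 + x) ^ R)⁻¹ * (8 * n) ^ (S + R + 1) * (1 + x)⁻¹ := by
          have : 1 + x ≠ 0 := by positivity
          rw [mul_inv, mul_inv]
          field_simp
      _ ≤ _ := mul_le_of_le_one_right (by positivity) (inv_le_one_of_one_le₀ (by linarith))

theorem isAdmissibleNorm_modulationNorm (hn : 0 < n) {η : Rn n → ℝ} (hη : IsUniformBump η)
    (p : ℝ≥0∞) {q : ℝ≥0∞} (hq : 0 < q) (s : ℝ) : IsAdmissibleNorm p (modulationNorm η p q s) := by
  obtain ⟨P, hP, hfin⟩ := exists_lqNorm_uniform_ne_top hn hq s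
  exact (hη.isSymbolFamily hn).isAdmissibleNorm_lqLp (w := fun k : Fin n → ℤ =>
    ENNReal.ofReal ((1 + ‖latticePt k‖ ^ 2) ^ (s / 2))) hq (by simp [latticePt_zero]) hP hfin

/-! ### Logarithmic polar coordinates -/

/-- The measure `e^{nτ} dτ` on the real line. -/
def logMeasure (n : ℕ) : Measure ℝ :=
  volume.withDensity fun τ => ENNReal.ofReal (Real.exp (n * τ))

instance (n : ℕ) : SFinite (logMeasure n) := by unfold logMeasure; infer_instance

/-- The map `(θ, τ) ↦ e^τ θ`. -/
def logPolar (z : Metric.sphere (0 : Rn n) 1 × ℝ) : Rn n := Real.exp z.2 • (z.1 : Rn n)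

/-- The surface measure on the unit sphere. -/
def surface (n : ℕ) : Measure (Metric.sphere (0 : Rn n) 1) := (volume : Measure (Rn n)).toSphere

instance (n : ℕ) : IsFiniteMeasure (surface n) := by unfold surface; infer_instance

/-- The substitution `r = e^τ` turns `r^{n-1} dr` into `e^{nτ} dτ`; `0 < n` guards the truncated
subtraction `n - 1`. -/
theorem measurePreserving_exp (hn : 0 < n) :
    MeasurePreserving Real.expOrderIso.toHomeomorph (logMeasure n)
      (Measure.volumeIoiPow (n - 1)) := by
  refine ⟨Real.expOrderIso.toHomeomorph.measurable, ?_⟩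
  ext B hB
  rw [Measure.map_apply Real.expOrderIso.toHomeomorph.measurable hB, logMeasure,
    withDensity_apply _ (Real.expOrderIso.toHomeomorph.measurable hB), Measure.volumeIoiPow,
    withDensity_apply _ hB, setLIntegral_subtype measurableSet_Ioi _
      fun a : ℝ => ENNReal.ofReal (a ^ (n - 1))]
  have himg : (Subtype.val '' B : Set ℝ) =
      Real.exp '' (Real.expOrderIso.toHomeomorph ⁻¹' B) := by
    ext r
    constructor
    · rintro ⟨b, hb, rfl⟩
      exact ⟨Real.expOrderIso.toHomeomorph.symm b, by simpa using hb,
        congrArg Subtype.val (Real.expOrderIso.toHomeomorph.apply_symm_apply b)⟩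
    · rintro ⟨τ, hτ, rfl⟩
      exact ⟨_, hτ, rfl⟩
  rw [himg, lintegral_image_eq_lintegral_abs_deriv_mul
    (Real.expOrderIso.toHomeomorph.measurable hB)
    (fun τ _ => (Real.hasDerivAt_exp τ).hasDerivWithinAt) Real.exp_injective.injOn]
  congr 1 with τ
  rw [← ENNReal.ofReal_mul (abs_nonneg _), abs_of_pos (Real.exp_pos _), ← pow_succ',
    Nat.sub_add_cancel hn, ← Real.exp_nat_mul]

theorem measurableEmbedding_logPolar : MeasurableEmbedding (logPolar (n := n)) := by
  have h1 : MeasurableEmbedding (fun z : Metric.sphere (0 : Rn n) 1 × ℝ =>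
      (homeomorphUnitSphereProd (Rn n)).symm
        (((Homeomorph.refl _).prodCongr Real.expOrderIso.toHomeomorph) z)) :=
    (homeomorphUnitSphereProd (Rn n)).symm.measurableEmbedding.comp
      ((Homeomorph.refl _).prodCongr Real.expOrderIso.toHomeomorph).measurableEmbedding
  exact (MeasurableEmbedding.subtype_coe (measurableSet_singleton (0 : Rn n)).compl).comp h1

theorem measurePreserving_logPolar (hn : 0 < n) :
    MeasurePreserving (logPolar (n := n)) ((surface n).prod (logMeasure n)) volume := by
  have : Nonempty (Fin n) := ⟨⟨0, hn⟩⟩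
  have h1 : MeasurePreserving (Prod.map id Real.expOrderIso.toHomeomorph)
      ((surface n).prod (logMeasure n)) ((surface n).prod (Measure.volumeIoiPow (n - 1))) :=
    (MeasurePreserving.id _).prod (measurePreserving_exp hn)
  have h2 := (volume : Measure (Rn n)).measurePreserving_homeomorphUnitSphereProd
  rw [finrank_euclideanSpace_fin] at h2
  have h3 := MeasurePreserving.symm (homeomorphUnitSphereProd (Rn n)).toMeasurableEquiv h2
  have h4 : MeasurePreserving (Subtype.val : ({0}ᶜ : Set (Rn n)) → Rn n)
      (Measure.comap Subtype.val volume) volume := by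
    have h5 := MeasurePreserving.mk measurable_subtype_coe
      (map_comap_subtype_coe (measurableSet_singleton (0 : Rn n)).compl volume)
    rwa [Measure.restrict_eq_self_of_ae_mem] at h5
    simp [ae_iff]
  exact h4.comp (h3.comp h1)

theorem norm_logPolar (z : Metric.sphere (0 : Rn n) 1 × ℝ) : ‖logPolar z‖ = Real.exp z.2 := by
  simp [logPolar, norm_smul]

theorem log_norm_logPolar (z : Metric.sphere (0 : Rn n) 1 × ℝ) :
    Real.log ‖logPolar z‖ = z.2 := by
  rw [norm_logPolar, Real.log_exp]

theorem lintegral_log_norm (hn : 0 < n) {G : ℝ → ℝ≥0∞} (hG : AEMeasurable G (logMeasure n)) :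
    ∫⁻ x : Rn n, G (Real.log ‖x‖) = surface n Set.univ * ∫⁻ τ, G τ ∂logMeasure n := by
  rw [← (measurePreserving_logPolar hn).lintegral_comp_emb measurableEmbedding_logPolar]
  simp_rw [log_norm_logPolar]
  have h := lintegral_prod_mul (μ := surface n) (ν := logMeasure n) (f := fun _ => 1) (g := G)
    aemeasurable_const hG
  simpa using h

theorem surface_univ_ne_zero (hn : 0 < n) : surface n Set.univ ≠ 0 := by
  have : Nonempty (Fin n) := ⟨⟨0, hn⟩⟩
  intro h
  have h1 := lintegral_log_norm hn (G := fun _ => 1) aemeasurable_const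
  rw [h, zero_mul] at h1
  simp at h1

/-- The density of the push-forward of `Φ dy` under `y ↦ log ‖y‖`. -/
def radialDensity (Φ : Rn n → ℂ) (τ : ℝ) : ℂ :=
  Real.exp (n * τ) • ∫ θ : Metric.sphere (0 : Rn n) 1, Φ (Real.exp τ • (θ : Rn n)) ∂surface n

/-- Fubini in logarithmic polar coordinates. With `b τ = f (e^{-τ} x)` it expresses `H_Φ f(x)`
through `radialDensity Φ` alone, for arbitrary `f` in the domain. -/
theorem integral_radialDensity (hn : 0 < n) {Φ : Rn n → ℂ} {b : ℝ → ℂ}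
    (h : Integrable fun y => Φ y * b (Real.log ‖y‖)) :
    Integrable (fun τ => radialDensity Φ τ * b τ) ∧
      ∫ y, Φ y * b (Real.log ‖y‖) = ∫ τ, radialDensity Φ τ * b τ := by
  have hd : Measurable fun τ : ℝ => ENNReal.ofReal (Real.exp (n * τ)) := by fun_prop
  have hdt : ∀ᵐ τ : ℝ, ENNReal.ofReal (Real.exp (n * τ)) < ⊤ :=
    Eventually.of_forall fun τ => ENNReal.ofReal_lt_top
  have h1 := ((measurePreserving_logPolar hn).integrable_comp_emb
    measurableEmbedding_logPolar).mpr h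
  have h2 : ((fun y => Φ y * b (Real.log ‖y‖)) ∘ logPolar) =
      fun z : Metric.sphere (0 : Rn n) 1 × ℝ => Φ (logPolar z) * b z.2 := by
    funext z
    simp only [Function.comp_apply, log_norm_logPolar]
  rw [h2] at h1
  have h3 : ∀ τ : ℝ, (ENNReal.ofReal (Real.exp (n * τ))).toReal •
      ∫ θ, Φ (logPolar (θ, τ)) * b τ ∂surface n = radialDensity Φ τ * b τ := by
    intro τ
    rw [integral_mul_const, ENNReal.toReal_ofReal (Real.exp_pos _).le, radialDensity,
      smul_mul_assoc]
    rfl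
  constructor
  · have h4 := h1.integral_prod_right
    rw [logMeasure, integrable_withDensity_iff_integrable_smul' hd hdt] at h4
    simpa only [h3] using h4
  · rw [← (measurePreserving_logPolar hn).integral_comp measurableEmbedding_logPolar]
    have h5 := integral_prod_symm _ h1
    simp only [log_norm_logPolar]
    rw [h5, logMeasure, integral_withDensity_eq_integral_toReal_smul hd hdt]
    simp only [h3]

theorem integrable_mul_comp_log_norm (hn : 0 < n) {Φ : Rn n → ℂ}
    (hΦ : LocallyIntegrableOn Φ {0}ᶜ volume) {b : ℝ → ℂ} (hb : Measurable b) {B M : ℝ}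
    (hB : ∀ τ, ‖b τ‖ ≤ B) (hM : ∀ τ, b τ ≠ 0 → |τ| ≤ M) :
    Integrable fun y => Φ y * b (Real.log ‖y‖) := by
  have : Nonempty (Fin n) := ⟨⟨0, hn⟩⟩
  let T : Set (Rn n) := {y | Real.exp (-M) ≤ ‖y‖ ∧ ‖y‖ ≤ Real.exp M}
  have hTc : IsClosed T := (isClosed_le continuous_const continuous_norm).inter
    (isClosed_le continuous_norm continuous_const)
  have hT : IsCompact T := (isCompact_closedBall (0 : Rn n) (Real.exp M)).of_isClosed_subset hTc
    fun y hy => by simpa using hy.2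
  have hT0 : T ⊆ {0}ᶜ := fun y hy h0 => by
    rw [Set.mem_singleton_iff] at h0
    have := hy.1
    rw [h0, norm_zero] at this
    exact absurd this (not_le.mpr (Real.exp_pos _))
  have h1 : Integrable (T.indicator Φ) :=
    (hΦ.integrableOn_compact_subset hT0 hT).integrable_indicator hTc.measurableSet
  have hbm : Measurable fun y : Rn n => b (Real.log ‖y‖) :=
    hb.comp (Real.measurable_log.comp measurable_norm)
  have h2 := h1.mul_bdd (c := B) hbm.aestronglyMeasurable (Eventually.of_forall fun y => hB _)
  refine h2.congr ?_
  have hne : ∀ᵐ y : Rn n, y ≠ 0 := by simp [ae_iff]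
  filter_upwards [hne] with y hy
  by_cases hyT : y ∈ T
  · rw [Set.indicator_of_mem hyT]
  · have hy0 : 0 < ‖y‖ := norm_pos_iff.mpr hy
    have hb0 : b (Real.log ‖y‖) = 0 := by
      by_contra h
      have h3 := abs_le.mp (hM _ h)
      exact hyT ⟨(Real.le_log_iff_exp_le hy0).mp h3.1, (Real.log_le_iff_le_exp hy0).mp h3.2⟩
    rw [hb0, mul_zero, mul_zero]

theorem locallyIntegrable_radialDensity (hn : 0 < n) {Φ : Rn n → ℂ}
    (hΦ : LocallyIntegrableOn Φ {0}ᶜ volume) : LocallyIntegrable (radialDensity Φ) := by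
  rw [locallyIntegrable_iff]
  intro K hK
  obtain ⟨M, hM⟩ := hK.isBounded.exists_norm_le
  have h1 := (integral_radialDensity hn (integrable_mul_comp_log_norm hn hΦ
    (b := K.indicator fun _ => (1 : ℂ)) (B := 1) (M := M)
    (measurable_const.indicator hK.measurableSet) (fun τ => by
      by_cases h : τ ∈ K <;> simp [h]) fun τ hτ => hM τ (by
      by_contra h; exact hτ (Set.indicator_of_notMem h _)))).1
  rw [← integrable_indicator_iff hK.measurableSet]
  refine h1.congr (Eventually.of_forall fun τ => ?_)
  by_cases h : τ ∈ K <;> simp [h]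

theorem isZeroOp_of_radialDensity (hn : 0 < n) {Φ : Rn n → ℂ}
    (h : ∀ᵐ τ, radialDensity Φ τ = 0) : IsZeroOp Φ := by
  have : Nonempty (Fin n) := ⟨⟨0, hn⟩⟩
  have hne : ∀ᵐ y : Rn n, y ≠ 0 := by simp [ae_iff]
  intro f hf
  filter_upwards [hf.2] with x hx
  have h1 : (fun y => Φ y * f (‖y‖⁻¹ • x)) =ᵐ[volume]
      fun y => Φ y * (fun τ => f (Real.exp (-τ) • x)) (Real.log ‖y‖) := by
    filter_upwards [hne] with y hy
    simp only [Real.exp_neg, Real.exp_log (norm_pos_iff.mpr hy)]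
  have h2 := (integral_radialDensity hn (b := fun τ => f (Real.exp (-τ) • x)) (hx.congr h1)).2
  refine ((integral_congr_ae h1).trans h2).trans ?_
  refine integral_eq_zero_of_ae ?_
  filter_upwards [h] with τ hτ
  simp [hτ]

/-! ### Radial test functions -/

/-- The radial function `x ↦ β(log ‖x‖ - 1)`. -/
def radialTest (β : ContDiffBump (0 : ℝ)) (x : Rn n) : ℂ :=
  (β.normed volume (Real.log ‖x‖ - 1) : ℂ)

theorem normed_eq_zero {β : ContDiffBump (0 : ℝ)} {τ : ℝ} (h : β.rOut ≤ |τ|) :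
    β.normed volume τ = 0 := by
  rw [ContDiffBump.normed_def, β.zero_of_le_dist (by simpa using h), zero_div]

theorem radialTest_mem (β : ContDiffBump (0 : ℝ)) (hβ : β.rOut ≤ 1) :
    radialTest β ∈ testAwayFromZero n := by
  have hsupp : ∀ x : Rn n, radialTest β x ≠ 0 → 1 ≤ ‖x‖ ∧ ‖x‖ ≤ Real.exp 2 := by
    intro x hx
    have h1 : |Real.log ‖x‖ - 1| < 1 := by
      by_contra h
      exact hx (by simp [radialTest, normed_eq_zero (hβ.trans (not_lt.mp h))])
    have h2 := abs_lt.mp h1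
    have h3 : 0 < ‖x‖ := by
      by_contra h
      have h0 : ‖x‖ = 0 := le_antisymm (not_lt.mp h) (norm_nonneg x)
      -- Because `Real.log 0 = 0`, the shift by 1 in `radialTest` is what makes the function vanish
      -- at the origin.
      rw [h0, Real.log_zero] at h2
      linarith [h2.1]
    refine ⟨?_, (Real.log_le_iff_le_exp h3).mp (by linarith)⟩
    rw [← Real.exp_zero]
    exact (Real.le_log_iff_exp_le h3).mp (by linarith)
  let T : Set (Rn n) := {y | 1 ≤ ‖y‖ ∧ ‖y‖ ≤ Real.exp 2}
  have hTc : IsClosed T := (isClosed_le continuous_const continuous_norm).inter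
    (isClosed_le continuous_norm continuous_const)
  have hT : IsCompact T := (isCompact_closedBall (0 : Rn n) (Real.exp 2)).of_isClosed_subset hTc
    fun y hy => by simpa using hy.2
  have htsupp : tsupport (radialTest (n := n) β) ⊆ T := closure_minimal (fun x hx => hsupp x hx) hTc
  refine ⟨?_, HasCompactSupport.of_support_subset_isCompact hT (fun x hx => hsupp x hx),
    fun h => ?_⟩
  · rw [contDiff_iff_contDiffAt]
    intro x
    by_cases hx : x = 0
    · subst hx
      have : radialTest β =ᶠ[𝓝 (0 : Rn n)] fun _ => 0 := by
        filter_upwards [Metric.ball_mem_nhds (0 : Rn n) one_pos] with y hy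
        by_contra h
        have := (hsupp y h).1
        rw [mem_ball_zero_iff] at hy
        linarith
      exact contDiffAt_const.congr_of_eventuallyEq this
    · have h1 : ContDiffAt ℝ ∞ (fun x : Rn n => Real.log ‖x‖ - 1) x :=
        ((contDiffAt_norm ℝ hx).log (norm_ne_zero_iff.mpr hx)).sub contDiffAt_const
      exact Complex.ofRealCLM.contDiff.contDiffAt.comp x
        ((β.contDiff_normed (n := ⊤)).contDiffAt.comp x h1)
  · have := (htsupp h).1
    rw [norm_zero] at this
    linarith

/-- Since `log (‖x‖ / ‖y‖) = log ‖x‖ - log ‖y‖`, the multiplicative structure of `H_Φ` becomes a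
convolution on the line. -/
theorem hausdorff_radialTest (hn : 0 < n) {Φ : Rn n → ℂ}
    (hΦ : LocallyIntegrableOn Φ {0}ᶜ volume) (β : ContDiffBump (0 : ℝ)) {x : Rn n} (hx : x ≠ 0) :
    hausdorff Φ (radialTest β) x =
      (β.normed volume ⋆[ContinuousLinearMap.lsmul ℝ ℝ, volume] radialDensity Φ)
        (Real.log ‖x‖ - 1) := by
  have : Nonempty (Fin n) := ⟨⟨0, hn⟩⟩
  have hne : ∀ᵐ y : Rn n, y ≠ 0 := by simp [ae_iff]
  set a := Real.log ‖x‖ - 1 with ha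
  let b : ℝ → ℂ := fun τ => (β.normed volume (a - τ) : ℂ)
  have h1 : (fun y => Φ y * radialTest β (‖y‖⁻¹ • x)) =ᵐ[volume]
      fun y => Φ y * b (Real.log ‖y‖) := by
    filter_upwards [hne] with y hy
    have h2 : Real.log ‖‖y‖⁻¹ • x‖ - 1 = a - Real.log ‖y‖ := by
      rw [norm_smul, norm_inv, norm_norm, Real.log_mul (inv_ne_zero (norm_ne_zero_iff.mpr hy))
        (norm_ne_zero_iff.mpr hx), Real.log_inv, ha]
      ring
    simp only [radialTest, h2, b]
  have hcont : Continuous b := Complex.continuous_ofReal.comp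
    ((β.contDiff_normed (n := 0)).continuous.comp (continuous_const.sub continuous_id))
  have hcs : HasCompactSupport b := by
    have h3 : HasCompactSupport (fun τ => β.normed volume (a - τ)) :=
      β.hasCompactSupport_normed.comp_homeomorph (Homeomorph.subLeft a)
    exact h3.comp_left (g := fun r : ℝ => (r : ℂ)) Complex.ofReal_zero
  obtain ⟨B, hB⟩ := hcs.exists_bound_of_continuous hcont
  obtain ⟨M, hM⟩ := hcs.isCompact.isBounded.exists_norm_le
  have hinteg := integrable_mul_comp_log_norm hn hΦ hcont.measurable hB
    fun τ hτ => hM τ (subset_tsupport _ hτ)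
  rw [hausdorff, integral_congr_ae h1, (integral_radialDensity hn hinteg).2, convolution_eq_swap]
  congr 1 with τ
  rw [ContinuousLinearMap.lsmul_apply, Complex.real_smul, mul_comm]

theorem continuous_normed_convolution {A : ℝ → ℂ} (hA : LocallyIntegrable A)
    (β : ContDiffBump (0 : ℝ)) :
    Continuous (β.normed volume ⋆[ContinuousLinearMap.lsmul ℝ ℝ, volume] A) :=
  β.hasCompactSupport_normed.continuous_convolution_left _
    (β.contDiff_normed (n := 0)).continuous hA

theorem continuousOn_hausdorff_radialTest (hn : 0 < n) {Φ : Rn n → ℂ}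
    (hΦ : LocallyIntegrableOn Φ {0}ᶜ volume) (β : ContDiffBump (0 : ℝ)) :
    ContinuousOn (hausdorff Φ (radialTest β)) {0}ᶜ := by
  have h1 : ContinuousOn (fun x : Rn n => Real.log ‖x‖ - 1) {0}ᶜ :=
    (continuous_norm.continuousOn.log fun x hx => norm_ne_zero_iff.mpr hx).sub continuousOn_const
  refine ((continuous_normed_convolution (locallyIntegrable_radialDensity hn hΦ)
    β).comp_continuousOn h1).congr fun x hx => ?_
  exact hausdorff_radialTest hn hΦ β hx

/-- The bump function on the line with radii `ε` and `2 ε`. -/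
def lineBump (ε : ℝ) (hε : 0 < ε) : ContDiffBump (0 : ℝ) := ⟨ε, 2 * ε, hε, by linarith⟩

/-- The normalized bump has height at most `ε⁻¹` on an interval of length `4ε`, so its `r`-th power
contributes at most `4 ε^{1-r}`. There `τ ≤ 1 + 2ε ≤ 2`, which bounds the weight by `e^{2n}`. -/
theorem exists_lintegral_radialTest_le (hn : 0 < n) {r : ℝ} (hr : 0 < r) :
    ∃ C : ℝ≥0∞, C ≠ ⊤ ∧ ∀ ε (hε : 0 < ε), ε ≤ 1 / 2 →
      ∫⁻ x : Rn n, ‖radialTest (lineBump ε hε) x‖ₑ ^ r ≤ C * ENNReal.ofReal (ε ^ (1 - r)) := by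
  refine ⟨surface n Set.univ * ENNReal.ofReal (Real.exp (n * 2) * 4),
    ENNReal.mul_ne_top (measure_ne_top _ _) ENNReal.ofReal_ne_top, fun ε hε hε1 => ?_⟩
  set β := lineBump ε hε with hβ
  let G : ℝ → ℝ≥0∞ := fun τ => ‖(β.normed volume (τ - 1) : ℂ)‖ₑ ^ r
  have hcont : Continuous fun τ => (β.normed volume (τ - 1) : ℂ) := Complex.continuous_ofReal.comp
    ((β.contDiff_normed (n := 0)).continuous.comp (continuous_id.sub continuous_const))
  have hG : Measurable G := (hcont.enorm.measurable).pow_const r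
  change ∫⁻ x : Rn n, G (Real.log ‖x‖) ≤ _
  rw [lintegral_log_norm hn hG.aemeasurable, mul_assoc]
  gcongr
  rw [logMeasure, lintegral_withDensity_eq_lintegral_mul _ (by fun_prop) hG]
  have hbound : ∀ τ, ((fun τ : ℝ => ENNReal.ofReal (Real.exp (n * τ))) * G) τ ≤
      (Set.Icc (1 - 2 * ε) (1 + 2 * ε)).indicator
        (fun _ => ENNReal.ofReal (Real.exp (n * 2) * ε ^ (-r))) τ := by
    intro τ
    by_cases hτ : τ ∈ Set.Icc (1 - 2 * ε) (1 + 2 * ε)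
    · rw [Set.indicator_of_mem hτ, Pi.mul_apply, ENNReal.ofReal_mul (by positivity)]
      have h1 : Real.exp (n * τ) ≤ Real.exp (n * 2) := by
        gcongr
        linarith [hτ.2]
      have h2 : ‖(β.normed volume (τ - 1) : ℂ)‖ₑ ≤ ENNReal.ofReal ε⁻¹ := by
        rw [← ofReal_norm, Complex.norm_real, Real.norm_of_nonneg (β.nonneg_normed _)]
        refine ENNReal.ofReal_le_ofReal ((β.normed_le_div_measure_closedBall_rIn volume _).trans ?_)
        have h3 : volume.real (Metric.closedBall (0 : ℝ) β.rIn) = 2 * ε := by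
          have : β.rIn = ε := rfl
          rw [this, Real.volume_real_closedBall hε.le]
        rw [h3, one_div]
        gcongr
        linarith
      gcongr
      calc G τ ≤ ENNReal.ofReal ε⁻¹ ^ r := ENNReal.rpow_le_rpow h2 hr.le
        _ = ENNReal.ofReal (ε ^ (-r)) := by
          rw [ENNReal.ofReal_rpow_of_pos (by positivity), Real.inv_rpow hε.le, Real.rpow_neg hε.le]
    · rw [Set.indicator_of_notMem hτ, Pi.mul_apply]
      have h1 : β.normed volume (τ - 1) = 0 := by
        refine normed_eq_zero ?_
        by_contra h
        have h2 : |τ - 1| < 2 * ε := not_le.mp h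
        have h3 := abs_lt.mp h2
        exact hτ ⟨by linarith, by linarith⟩
      simp [G, h1, hr]
  refine (lintegral_mono hbound).trans ?_
  rw [lintegral_indicator_const measurableSet_Icc, Real.volume_Icc,
    ← ENNReal.ofReal_mul (by positivity), ← ENNReal.ofReal_mul (by positivity)]
  refine ENNReal.ofReal_le_ofReal (le_of_eq ?_)
  rw [sub_eq_add_neg 1 r, Real.rpow_add hε, Real.rpow_one]
  ring

/-- If `H_Φ` is bounded on `L^r`, `r < 1`, at radial test functions, then `H_Φ = 0`. -/
theorem isZeroOp_of_lintegral_le (hn : 0 < n) {Φ : Rn n → ℂ}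
    (hΦ : LocallyIntegrableOn Φ {0}ᶜ volume) {r : ℝ} (hr₀ : 0 < r) (hr₁ : r < 1) {C : ℝ≥0∞}
    (hC : C ≠ ⊤) (h : ∀ f ∈ testAwayFromZero n, ContinuousOn (hausdorff Φ f) {0}ᶜ →
      ∫⁻ x, ‖hausdorff Φ f x‖ₑ ^ r ≤ C * ∫⁻ x, ‖f x‖ₑ ^ r) : IsZeroOp Φ := by
  have : Nonempty (Fin n) := ⟨⟨0, hn⟩⟩
  have hne : ∀ᵐ y : Rn n, y ≠ 0 := by simp [ae_iff]
  refine isZeroOp_of_radialDensity hn ?_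
  set A := radialDensity Φ with hAdef
  have hA : LocallyIntegrable A := locallyIntegrable_radialDensity hn hΦ
  obtain ⟨C₁, hC₁, htest⟩ := exists_lintegral_radialTest_le hn hr₀
  let ε : ℕ → ℝ := fun k => 1 / 2 * (1 / ((k : ℝ) + 1))
  have hε : ∀ k, 0 < ε k := fun k => by positivity
  have hεle : ∀ k, ε k ≤ 1 / 2 := fun k => by
    refine mul_le_of_le_one_right (by norm_num) ?_
    rw [div_le_one (by positivity)]
    linarith [k.cast_nonneg (α := ℝ)]
  have hε0 : Tendsto ε atTop (𝓝 0) := by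
    simpa [ε] using (tendsto_one_div_add_atTop_nhds_zero_nat (𝕜 := ℝ)).const_mul (1 / 2 : ℝ)
  let β : ℕ → ContDiffBump (0 : ℝ) := fun k => lineBump (ε k) (hε k)
  let T : ℕ → ℝ → ℂ := fun k =>
    (β k).normed volume ⋆[ContinuousLinearMap.lsmul ℝ ℝ, volume] A
  have hTc : ∀ k, Continuous (T k) := fun k => continuous_normed_convolution hA (β k)
  have hmeas : ∀ k, Measurable fun τ => ‖T k (τ - 1)‖ₑ ^ r := fun k =>
    (((hTc k).comp (continuous_id.sub continuous_const)).enorm.measurable).pow_const r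
  set S := surface n Set.univ with hS
  have hS0 : S ≠ 0 := surface_univ_ne_zero hn
  have hStop : S ≠ ⊤ := measure_ne_top _ _
  have hle : ∀ k, S * ∫⁻ τ, ‖T k (τ - 1)‖ₑ ^ r ∂logMeasure n ≤
      C * (C₁ * ENNReal.ofReal (ε k ^ (1 - r))) := by
    intro k
    rw [hS, ← lintegral_log_norm hn (hmeas k).aemeasurable]
    have h1 := h _ (radialTest_mem (β k) (by
      change 2 * ε k ≤ 1; linarith [hεle k])) (continuousOn_hausdorff_radialTest hn hΦ (β k))
    refine le_trans (le_of_eq (lintegral_congr_ae ?_)) (h1.trans ?_)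
    · filter_upwards [hne] with x hx
      rw [hausdorff_radialTest hn hΦ (β k) hx]
    · gcongr
      exact htest (ε k) (hε k) (hεle k)
  have hrad : Tendsto (fun k => (β k).rOut) atTop (𝓝 0) := by
    simpa using! hε0.const_mul 2
  have hconv : ∀ᵐ τ, Tendsto (fun k => T k τ) atTop (𝓝 (A τ)) :=
    ContDiffBump.ae_convolution_tendsto_right_of_locallyIntegrable (K := 2) hrad
      (Eventually.of_forall fun k => le_rfl) hA
  have hshift : Measure.QuasiMeasurePreserving (fun τ : ℝ => τ - 1) (logMeasure n) volume :=
    (measurePreserving_sub_right volume (1 : ℝ)).quasiMeasurePreserving.mono_left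
      (withDensity_absolutelyContinuous _ _)
  have hlim0 :
      Tendsto (fun k => S⁻¹ * (C * (C₁ * ENNReal.ofReal (ε k ^ (1 - r))))) atTop (𝓝 0) := by
    have h1 : Tendsto (fun k => ε k ^ (1 - r)) atTop (𝓝 0) := by
      have h2 := hε0.rpow_const (p := 1 - r) (Or.inr (by linarith))
      rwa [Real.zero_rpow (by linarith)] at h2
    have h3 : Tendsto (fun k => ENNReal.ofReal (ε k ^ (1 - r))) atTop (𝓝 0) := by
      simpa [Function.comp_def] using (ENNReal.continuous_ofReal.tendsto 0).comp h1
    have h4 := ENNReal.Tendsto.const_mul (ENNReal.Tendsto.const_mul (ENNReal.Tendsto.const_mul h3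
      (Or.inr hC₁)) (Or.inr hC)) (Or.inr (ENNReal.inv_ne_top.mpr hS0))
    simpa using h4
  -- Fatou's lemma: the convolutions tend to `A` almost everywhere, while their integrals are
  -- `O(ε^{1-r})`. Here `r < 1` is decisive.
  have hzero : ∫⁻ τ, ‖A (τ - 1)‖ₑ ^ r ∂logMeasure n = 0 := by
    refine le_antisymm ?_ zero_le
    calc ∫⁻ τ, ‖A (τ - 1)‖ₑ ^ r ∂logMeasure n
        = ∫⁻ τ, liminf (fun k => ‖T k (τ - 1)‖ₑ ^ r) atTop ∂logMeasure n := by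
          refine lintegral_congr_ae ?_
          filter_upwards [hshift.ae hconv] with τ hτ
          exact (((ENNReal.continuous_rpow_const.tendsto _).comp
            ((continuous_enorm.tendsto _).comp hτ)).liminf_eq).symm
      _ ≤ liminf (fun k => ∫⁻ τ, ‖T k (τ - 1)‖ₑ ^ r ∂logMeasure n) atTop :=
          lintegral_liminf_le fun k => hmeas k
      _ ≤ liminf (fun k => S⁻¹ * (C * (C₁ * ENNReal.ofReal (ε k ^ (1 - r))))) atTop := by
          refine liminf_le_liminf (Eventually.of_forall fun k => ?_)
          rw [← ENNReal.div_eq_inv_mul, ENNReal.le_div_iff_mul_le (Or.inl hS0) (Or.inl hStop),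
            mul_comm]
          exact hle k
      _ = 0 := hlim0.liminf_eq
  have hAm : AEMeasurable (fun τ => ‖A (τ - 1)‖ₑ ^ r) (logMeasure n) :=
    ((hA.aestronglyMeasurable.comp_quasiMeasurePreserving hshift).enorm).pow_const r
  have hae := (lintegral_eq_zero_iff' hAm).mp hzero
  -- The density `e^{nτ}` never vanishes, so `logMeasure` and Lebesgue measure have the same null
  -- sets.
  have hvol : ∀ᵐ τ : ℝ, A (τ - 1) = 0 := by
    have h1 : (volume : Measure ℝ) ≪ logMeasure n :=
      withDensity_absolutelyContinuous' (by fun_prop)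
        (Eventually.of_forall fun τ => by simp [Real.exp_pos])
    filter_upwards [h1.ae_le hae] with τ hτ
    simpa [hr₀, hr₀.le, not_lt.mpr hr₀.le] using hτ
  have h2 := (measurePreserving_add_right volume (1 : ℝ)).quasiMeasurePreserving.ae hvol
  filter_upwards [h2] with τ hτ
  simpa using hτ

/-! ### The equivalence for an arbitrary admissible norm. -/

theorem IsAdmissibleNorm.isBoundedOn_iff (hn : 0 < n) {p : ℝ≥0∞} (hp₀ : 0 < p) (hp₁ : p < 1)
    {N : 𝓢'(Rn n, ℂ) → ℝ≥0∞} (hN : IsAdmissibleNorm p N) {Φ : Rn n → ℂ}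
    (hΦ : LocallyIntegrableOn Φ {0}ᶜ volume) {𝒟 : Set (Rn n → ℂ)}
    (h𝒟_test : testAwayFromZero n ⊆ 𝒟) (h𝒟_dom : 𝒟 ⊆ hausdorffDomain Φ) :
    IsBoundedOn Φ 𝒟 N ↔ IsZeroOp Φ := by
  constructor
  · intro hb
    obtain ⟨C, hC, h⟩ := exists_lintegral_hausdorff_le hn hp₀ hp₁ hN h𝒟_test hb
    have hptop : p ≠ ⊤ := (hp₁.trans ENNReal.one_lt_top).ne
    refine isZeroOp_of_lintegral_le hn hΦ (ENNReal.toReal_pos hp₀.ne' hptop) ?_ hC h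
    simpa using (ENNReal.toReal_lt_toReal hptop ENNReal.one_ne_top).mpr hp₁
  · intro hz
    -- The zero distribution represents `H_Φ f`, with constant 0. The inclusion of `𝒟` in the
    -- natural domain enters here, since `IsZeroOp` speaks only of that domain.
    refine ⟨0, fun f hf u _ _ => ⟨0, ⟨?_, fun g _ => ?_⟩, by simp [hN.map_zero]⟩⟩
    · have h1 : (fun _ : Rn n => (0 : ℂ)) =ᵐ[volume] hausdorff Φ f :=
        (hz f (h𝒟_dom hf)).mono fun x hx => hx.symm
      exact ((integrable_zero _ _ _).congr h1).locallyIntegrable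
    · have h1 : (fun x => g x * hausdorff Φ f x) =ᵐ[volume] fun _ => 0 :=
        (hz f (h𝒟_dom hf)).mono fun x hx => by simp [hx]
      rw [integral_congr_ae h1]
      simp

end HausdorffOp

end

theorem mainTheorem3 (n : ℕ) (hn : 0 < n) (p q : ℝ≥0∞) (hp₀ : 0 < p) (hp₁ : p < 1) (hq : 0 < q)
    (s : ℝ) (φ : HausdorffOp.Rn n → ℝ) (hφ : HausdorffOp.IsDyadicBump φ)
    (η : HausdorffOp.Rn n → ℝ) (hη : HausdorffOp.IsUniformBump η)
    (Φ : HausdorffOp.Rn n → ℂ) (hΦ : LocallyIntegrableOn Φ {0}ᶜ volume)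
    (𝒟 : Set (HausdorffOp.Rn n → ℂ)) (h𝒟_test : HausdorffOp.testAwayFromZero n ⊆ 𝒟)
    (h𝒟_dom : 𝒟 ⊆ HausdorffOp.hausdorffDomain Φ) :
    (HausdorffOp.IsBoundedOn Φ 𝒟 (HausdorffOp.triebelLizorkinNorm φ p q s) ↔
      HausdorffOp.IsZeroOp Φ) ∧
    (HausdorffOp.IsBoundedOn Φ 𝒟 (HausdorffOp.besovNorm φ p q s) ↔
      HausdorffOp.IsZeroOp Φ) ∧
    (HausdorffOp.IsBoundedOn Φ 𝒟 (HausdorffOp.modulationNorm η p q s) ↔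
      HausdorffOp.IsZeroOp Φ) := by
  exact ⟨(HausdorffOp.isAdmissibleNorm_triebelLizorkinNorm hφ p hq s).isBoundedOn_iff hn hp₀ hp₁ hΦ
      h𝒟_test h𝒟_dom,
    (HausdorffOp.isAdmissibleNorm_besovNorm hφ p hq s).isBoundedOn_iff hn hp₀ hp₁ hΦ
      h𝒟_test h𝒟_dom,
    (HausdorffOp.isAdmissibleNorm_modulationNorm hn hη p hq s).isBoundedOn_iff hn hp₀ hp₁ hΦ
      h𝒟_test h𝒟_dom⟩
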